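/- Let $\widetilde L^{-1}(0)\subset\mathbb C^8$ be the set of $(z_1,\dots,z_8)$ with $|z_1|^2+|z_5|^2=6$, $|z_2|^2+|z_5|^2+|z_7|^2=10$, $|z_3|^2+|z_7|^2=6$, $|z_4|^2-|z_5|^2+|z_7|^2=4$, $|z_5|^2-|z_6|^2+|z_7|^2=2$, $|z_5|^2-|z_7|^2+|z_8|^2=4$, and let $N\cong\mathbb T^6$ act on $\mathbb C^8$ by $$(\theta,z)\mapsto(e^{i\theta_1}z_1,e^{i\theta_2}z_2,e^{i\theta_3}z_3,e^{i\theta_4}z_4,e^{i(\theta_1+\theta_2-\theta_4-\theta_5+\theta_6)}z_5,e^{i\theta_5}z_6,e^{i(\theta_2+\theta_3+\theta_4-\theta_5-\theta_6)}z_7,e^{i\theta_6}z_8).$$ Let $M=\widetilde L^{-1}(0)/N$ be the resulting $4$-dimensional symplectic quotient, with the symplectic form $\omega$ induced by $\omega_{st}=-\frac i2\sum_k dz_k\wedge d\bar z_k$. On $M$ put $$J([z])=\tfrac12|z_1|^2,\quad H([z])=\tfrac12|z_3|^2,\quad X([z])=\Re(\overline{z_2}\,\overline{z_3}\,\overline{z_4}\,z_6z_7z_8),\quad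 H_t=(1-2t)H+t\gamma X,\quad F_t=(J,H_t),$$ where $\gamma>0$ and $t\in[0,1]$. Let $\mathfrak f(\zeta)=(2+\zeta)(6+\zeta)(8-\zeta)(4-\zeta)(2-\zeta)$. There exist smooth functions $u_-,u_+,v_-,v_+:[0,1]\to[-\sqrt2,\sqrt2]$ such that, for all $t\in[0,1]$, $u=u_\pm(t)$ solves $$(1-2t)\,u\sqrt{\mathfrak f(u^2)}+\gamma t\,\mathfrak f(u^2)+\gamma t\,u^2\,\mathfrak f'(u^2)=0,$$ $v=v_\pm(t)$ solves $$-(1-2t)\,v\sqrt{\mathfrak f(v^2)}+\gamma t\,\mathfrak f(v^2)+\gamma t\,v^2\,\mathfrak f'(v^2)=0,$$ and $u_-(0)=0$, $u_+(0)=\sqrt2$, $v_-(0)=-\sqrt2$, $v_+(0)=0$. For any such functions and for every $t\in[0,1]$, the four points $P_t^{min}=p(u_-(t))$, $P_t^{max}=p(u_+(t))$, $Q_t^{min}=q(v_-(t))$, $Q_t^{max}=q(v_+(t))$ of $M$, where $$p(u)=\left[0,u,\sqrt{2+u^2},\sqrt{6+u^2},\sqrt6,\sqrt{8-u^2},\sqrt{4-u^2},\sqrt{2-u^2}\right],$$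 $$q(v)=\left[\sqrt6,\sqrt{8-v^2},\sqrt{4-v^2},\sqrt{2-v^2},0,v,\sqrt{2+v^2},\sqrt{6+v^2}\right],$$ are nondegenerate fixed points of $F_t$ of elliptic-elliptic type. Here a fixed point $p$ (i.e. $dJ(p)=dH_t(p)=0$) is nondegenerate if $\omega_p^{-1}d^2J(p)$ and $\omega_p^{-1}d^2H_t(p)$ span a Cartan subalgebra of $\mathfrak{sp}(T_pM,\omega_p)$. A nondegenerate fixed point is of elliptic-elliptic type if this span contains elements with four distinct eigenvalues and the eigenvalues of every such element are of the form $\pm i\alpha,\pm i\beta$ with $\alpha,\beta>0$, $\alpha\neq\beta$. -/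

import Mathlib

open scoped ContDiff

noncomputable section

namespace Octagon

/-! ### The symplectic quotient -/

/-- `ℂ⁸`. The coordinates `z₁, …, z₈` are `z 0, …, z 7`. -/
abbrev C8 : Type := Fin 8 → ℂ

/-- The zero level set of the momentum map of the `T⁶`-action on `ℂ⁸`
(the six manifold equations). -/
def levelSet : Set C8 :=
  {z | ‖z 0‖ ^ 2 + ‖z 4‖ ^ 2 = 6 ∧
       ‖z 1‖ ^ 2 + ‖z 4‖ ^ 2 + ‖z 6‖ ^ 2 = 10 ∧
       ‖z 2‖ ^ 2 + ‖z 6‖ ^ 2 = 6 ∧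
       ‖z 3‖ ^ 2 - ‖z 4‖ ^ 2 + ‖z 6‖ ^ 2 = 4 ∧
       ‖z 4‖ ^ 2 - ‖z 5‖ ^ 2 + ‖z 6‖ ^ 2 = 2 ∧
       ‖z 4‖ ^ 2 - ‖z 6‖ ^ 2 + ‖z 7‖ ^ 2 = 4}

/-- The angles by which `θ ∈ ℝ⁶` (inducing the torus `N ≅ T⁶ ⊆ T⁸`) rotates `z₁, …, z₈`. -/
def angle (θ : Fin 6 → ℝ) : Fin 8 → ℝ :=
  ![θ 0, θ 1, θ 2, θ 3, θ 0 + θ 1 - θ 3 - θ 4 + θ 5, θ 4, θ 1 + θ 2 + θ 3 - θ 4 - θ 5, θ 5]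

/-- The action of `N` on `ℂ⁸`. -/
def rotate (θ : Fin 6 → ℝ) (z : C8) : C8 :=
  fun k => Complex.exp (angle θ k * Complex.I) * z k

theorem angle_zero : angle 0 = 0 := by
  funext k; fin_cases k <;> simp [angle]

theorem angle_neg (θ : Fin 6 → ℝ) : angle (-θ) = -angle θ := by
  funext k; fin_cases k <;> simp [angle] <;> ring

theorem angle_add (θ η : Fin 6 → ℝ) : angle (θ + η) = angle θ + angle η := by
  funext k; fin_cases k <;> simp [angle] <;> ring

theorem rotate_zero (z : C8) : rotate 0 z = z := by
  funext k; simp [rotate, angle_zero]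

theorem rotate_add (θ η : Fin 6 → ℝ) (z : C8) :
    rotate (θ + η) z = rotate θ (rotate η z) := by
  funext k
  simp only [rotate, angle_add, Pi.add_apply, Complex.ofReal_add, add_mul, Complex.exp_add]
  ring

theorem norm_rotate (θ : Fin 6 → ℝ) (z : C8) (k : Fin 8) : ‖rotate θ z k‖ = ‖z k‖ := by
  simp [rotate, Complex.norm_exp_ofReal_mul_I]

/-- Two points of the level set are equivalent if they lie in the same `N`-orbit. -/
def orbitSetoid : Setoid levelSet where
  r z w := ∃ θ : Fin 6 → ℝ, rotate θ z.1 = w.1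
  iseqv :=
    { refl := fun z => ⟨0, rotate_zero z.1⟩
      symm := by
        rintro z w ⟨θ, h⟩
        refine ⟨-θ, ?_⟩
        rw [← h, ← rotate_add, neg_add_cancel, rotate_zero]
      trans := by
        rintro z w v ⟨θ, h⟩ ⟨η, h'⟩
        refine ⟨η + θ, ?_⟩
        rw [rotate_add, h, h'] }

/-- The four-dimensional manifold `M`, the quotient of the level set by `N`. -/
def M : Type := Quotient orbitSetoid

/-- The quotient map `z ↦ [z]`. -/
def toM (z : levelSet) : M := Quotient.mk orbitSetoid z

/-! ### The functions on the quotient -/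

/-- `Z(z) = z̄₂ z̄₃ z̄₄ z₆ z₇ z₈`. -/
def Zfun (z : C8) : ℂ :=
  starRingEnd ℂ (z 1) * starRingEnd ℂ (z 2) * starRingEnd ℂ (z 3) * z 5 * z 6 * z 7

theorem Zfun_rotate (θ : Fin 6 → ℝ) (z : C8) : Zfun (rotate θ z) = Zfun z := by
  have h : Complex.exp (-(θ 1 * Complex.I)) * Complex.exp (-(θ 2 * Complex.I)) *
      Complex.exp (-(θ 3 * Complex.I)) * Complex.exp (θ 4 * Complex.I) *
      Complex.exp ((θ 1 + θ 2 + θ 3 - θ 4 - θ 5) * Complex.I) *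
      Complex.exp (θ 5 * Complex.I) = 1 := by
    simp only [← Complex.exp_add]
    rw [← Complex.exp_zero]
    congr 1
    ring
  simp only [Zfun, rotate, map_mul, ← Complex.exp_conj, Complex.conj_ofReal, Complex.conj_I,
    mul_neg]
  simp only [angle, Matrix.cons_val, Complex.ofReal_add, Complex.ofReal_sub]
  linear_combination (starRingEnd ℂ (z 1) * starRingEnd ℂ (z 2) * starRingEnd ℂ (z 3) *
    z 5 * z 6 * z 7) * h

/-- `J([z]) = |z₁|² / 2`. -/
def J : M → ℝ :=
  Quotient.lift (fun z : levelSet => ‖z.1 0‖ ^ 2 / 2) (by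
    rintro z w ⟨θ, h⟩
    simp only [← h, norm_rotate])

/-- `H([z]) = |z₃|² / 2`. -/
def H : M → ℝ :=
  Quotient.lift (fun z : levelSet => ‖z.1 2‖ ^ 2 / 2) (by
    rintro z w ⟨θ, h⟩
    simp only [← h, norm_rotate])

/-- `X([z]) = Re (z̄₂ z̄₃ z̄₄ z₆ z₇ z₈)`. -/
def X : M → ℝ :=
  Quotient.lift (fun z : levelSet => (Zfun z.1).re) (by
    rintro z w ⟨θ, h⟩
    simp only [← h, Zfun_rotate])

/-- `H_t = (1 - 2t) H + t γ X`. -/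
def Ht (γ t : ℝ) (p : M) : ℝ := (1 - 2 * t) * H p + t * γ * X p

/-! ### The charts -/

/-- The outer normals of the edges of the octagon, counterclockwise from the left edge. -/
def normal : Fin 8 → ℝ × ℝ :=
  ![(-1, 0), (-1, -1), (0, -1), (1, -1), (1, 0), (1, 1), (0, 1), (-1, 1)]

/-- The octagon is `{x | ⟨x, normal k⟩ ≤ offset k for all k}`. -/
def offset : Fin 8 → ℝ := ![0, -1, 0, 2, 3, 5, 3, 2]

/-- The determinant of the `k`-th and the `l`-th normal. -/
def det2 (k l : Fin 8) : ℝ := (normal k).1 * (normal l).2 - (normal k).2 * (normal l).1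

/-- The manifold equations solved for `|z_k|²` in terms of `a = |z_ν|²` and `b = |z_{ν+1}|²`
(indices modulo `8`; consecutive normals have determinant `1`). For instance
`|z₃|² = 2 - |z₁|² + |z₂|²` in terms of `z₁, z₂`. -/
def sqMod (ν : Fin 8) (a b : ℝ) (k : Fin 8) : ℝ :=
  2 * offset k - det2 k (ν + 1) * (2 * offset ν - a) - det2 ν k * (2 * offset (ν + 1) - b)

/-- `|z_k|²` as a function of the coordinates `x = (x_ν, y_ν, x_{ν+1}, y_{ν+1})`. -/
def sqAt (ν : Fin 8) (x : Fin 4 → ℝ) (k : Fin 8) : ℝ :=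
  sqMod ν (x 0 ^ 2 + x 1 ^ 2) (x 2 ^ 2 + x 3 ^ 2) k

/-- The image `V_ν ⊆ ℝ⁴` of the `ν`-th chart: all `z_k` with `k ≠ ν, ν + 1` are nonzero. -/
def V (ν : Fin 8) : Set (Fin 4 → ℝ) := {x | ∀ k, k ≠ ν → k ≠ ν + 1 → 0 < sqAt ν x k}

/-- The section of the quotient map over the `ν`-th chart domain: `z_ν = x_ν + i y_ν`,
`z_{ν+1} = x_{ν+1} + i y_{ν+1}`, and all other `z_k` are positive reals. -/
def lift (ν : Fin 8) (x : Fin 4 → ℝ) : C8 := fun k =>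
  if k = ν then ⟨x 0, x 1⟩ else if k = ν + 1 then ⟨x 2, x 3⟩ else (√(sqAt ν x k) : ℝ)

theorem norm_mk_sq (a b : ℝ) : ‖(⟨a, b⟩ : ℂ)‖ ^ 2 = a ^ 2 + b ^ 2 := by
  rw [← Complex.normSq_eq_norm_sq, Complex.normSq_mk]; ring

theorem sqAt_self (ν : Fin 8) (x : Fin 4 → ℝ) : sqAt ν x ν = x 0 ^ 2 + x 1 ^ 2 := by
  fin_cases ν <;> simp [sqAt, sqMod, det2, normal, offset]

theorem sqAt_succ (ν : Fin 8) (x : Fin 4 → ℝ) : sqAt ν x (ν + 1) = x 2 ^ 2 + x 3 ^ 2 := by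
  fin_cases ν <;> simp [sqAt, sqMod, det2, normal, offset]

theorem norm_lift_sq {ν : Fin 8} {x : Fin 4 → ℝ} (hx : x ∈ V ν) (k : Fin 8) :
    ‖lift ν x k‖ ^ 2 = sqAt ν x k := by
  unfold lift
  split_ifs with h1 h2
  · rw [h1, sqAt_self, norm_mk_sq]
  · rw [h2, sqAt_succ, norm_mk_sq]
  · rw [Complex.norm_real, Real.norm_eq_abs, sq_abs, Real.sq_sqrt (hx k h1 h2).le]

theorem lift_mem {ν : Fin 8} {x : Fin 4 → ℝ} (hx : x ∈ V ν) : lift ν x ∈ levelSet := by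
  simp only [levelSet, Set.mem_ofPred_eq, norm_lift_sq hx, sqAt, sqMod]
  generalize 2 * offset ν - (x 0 ^ 2 + x 1 ^ 2) = A
  generalize 2 * offset (ν + 1) - (x 2 ^ 2 + x 3 ^ 2) = B
  simp only [det2]
  generalize normal ν = m
  generalize normal (ν + 1) = n
  simp only [offset, normal, Matrix.cons_val]
  refine ⟨?_, ?_, ?_, ?_, ?_, ?_⟩ <;> ring

/-- The inverse `ψ_ν⁻¹ : V_ν → M` of the `ν`-th chart. -/
def param (ν : Fin 8) (x : V ν) : M := toM ⟨lift ν x.1, lift_mem x.2⟩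

open Classical in
/-- The coordinate representation `f ∘ ψ_ν⁻¹` of a function on `M` (extended by `0` outside the
open set `V_ν`). -/
def localRep (f : M → ℝ) (ν : Fin 8) (x : Fin 4 → ℝ) : ℝ :=
  if hx : x ∈ V ν then f (param ν ⟨x, hx⟩) else 0

/-- The standard symplectic form on `ℂ⁸`, with the convention `ω(∂_{x_k}, ∂_{y_k}) = -1`. -/
def omegaStd (v w : C8) : ℝ := ∑ k, ((v k).im * (w k).re - (v k).re * (w k).im)

/-- The matrix of the reduced symplectic form in the `ν`-th chart: the pullback of the standard
form on `ℂ⁸` under the section `lift ν`. -/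
def omega (ν : Fin 8) (x : Fin 4 → ℝ) : Matrix (Fin 4) (Fin 4) ℝ :=
  Matrix.of fun i j =>
    omegaStd (fderiv ℝ (lift ν) x (Pi.single i 1)) (fderiv ℝ (lift ν) x (Pi.single j 1))

/-- The matrix of the Hessian of `f` in the `ν`-th chart. -/
def hessian (f : M → ℝ) (ν : Fin 8) (x : Fin 4 → ℝ) : Matrix (Fin 4) (Fin 4) ℝ :=
  Matrix.of fun i j =>
    fderiv ℝ (fderiv ℝ (localRep f ν)) x (Pi.single i 1) (Pi.single j 1)

/-- The linearisation `ω⁻¹ d²f` in the `ν`-th chart; `S ↦ ω⁻¹ S` identifies the Lie algebra of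
quadratic forms on the tangent space with the symplectic Lie algebra. -/
def linearization (f : M → ℝ) (ν : Fin 8) (x : Fin 4 → ℝ) : Matrix (Fin 4) (Fin 4) ℝ :=
  (omega ν x)⁻¹ * hessian f ν x

/-! ### Fixed points and their type

The notions below do not depend on the chart that is used around the point. -/

/-- `f` and `g` are smooth near the point with coordinates `x` and both differentials vanish
there (a point of rank zero of `(f, g)`). -/
def IsFixedAt (f g : M → ℝ) (ν : Fin 8) (x : Fin 4 → ℝ) : Prop :=
  ContDiffAt ℝ ∞ (localRep f ν) x ∧ ContDiffAt ℝ ∞ (localRep g ν) x ∧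
    fderiv ℝ (localRep f ν) x = 0 ∧ fderiv ℝ (localRep g ν) x = 0

/-- The linear span of the linearisations of `f` and `g`. -/
def linSpan (f g : M → ℝ) (ν : Fin 8) (x : Fin 4 → ℝ) :
    Submodule ℝ (Matrix (Fin 4) (Fin 4) ℝ) :=
  Submodule.span ℝ {linearization f ν x, linearization g ν x}

attribute [local instance] LieRing.ofAssociativeRing

/-- The span is a Cartan subalgebra of the symplectic Lie algebra of the tangent space. -/
def SpansCartan (f g : M → ℝ) (ν : Fin 8) (x : Fin 4 → ℝ) : Prop :=
  ∃ 𝔥 : LieSubalgebra ℝ (skewAdjointMatricesLieSubalgebra (omega ν x)),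
    𝔥.IsCartanSubalgebra ∧ ∀ A : Matrix (Fin 4) (Fin 4) ℝ, A ∈ linSpan f g ν x ↔
      ∃ hA : A ∈ skewAdjointMatricesLieSubalgebra (omega ν x), ⟨A, hA⟩ ∈ 𝔥

/-- The complex eigenvalues of a real matrix. -/
def eigenvaluesC (C : Matrix (Fin 4) (Fin 4) ℝ) : Set ℂ := spectrum ℂ (C.map Complex.ofReal)

/-- `C` has four distinct eigenvalues. -/
def IsRegularElement (C : Matrix (Fin 4) (Fin 4) ℝ) : Prop := (eigenvaluesC C).ncard = 4

/-- The eigenvalues of `C` are `± i α, ± i β` with real nonzero `α ≠ β`. -/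
def HasEllipticEllipticEigenvalues (C : Matrix (Fin 4) (Fin 4) ℝ) : Prop :=
  ∃ α β : ℝ, 0 < α ∧ 0 < β ∧ α ≠ β ∧
    eigenvaluesC C = {α * Complex.I, -(α * Complex.I), β * Complex.I, -(β * Complex.I)}

/-- `p` is a nondegenerate fixed point of `(f, g)`. -/
def IsNondegenerateFixedPoint (f g : M → ℝ) (p : M) : Prop :=
  ∃ (ν : Fin 8) (x : V ν), param ν x = p ∧ IsFixedAt f g ν x ∧ SpansCartan f g ν x

/-- `p` is a nondegenerate fixed point of `(f, g)` of elliptic-elliptic type: in addition,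
regular elements of the Cartan subalgebra exist, and all of them have two elliptic blocks. -/
def IsEllipticElliptic (f g : M → ℝ) (p : M) : Prop :=
  ∃ (ν : Fin 8) (x : V ν), param ν x = p ∧ IsFixedAt f g ν x ∧ SpansCartan f g ν x ∧
    (∃ C ∈ linSpan f g ν x, IsRegularElement C) ∧
    ∀ C ∈ linSpan f g ν x, IsRegularElement C → HasEllipticEllipticEigenvalues C

/-! ### The moving points -/

/-- `𝔣(ζ) = (2 + ζ)(6 + ζ)(8 - ζ)(4 - ζ)(2 - ζ)`. -/
def ff (ζ : ℝ) : ℝ := (2 + ζ) * (6 + ζ) * (8 - ζ) * (4 - ζ) * (2 - ζ)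

/-- A smooth map `u : [0,1] → [-√2, √2]` with `u 0 = u₀` and, on `[0,1]`,
`s (1 - 2t) u √𝔣(u²) + γ t 𝔣(u²) + γ t u² 𝔣'(u²) = 0`, where `s` is a sign. Only the values
of `u` on `[0,1]` matter. -/
structure IsBranch (γ s u₀ : ℝ) (u : ℝ → Set.Icc (-√2) √2) : Prop where
  smooth : ContDiffOn ℝ ∞ (fun t => (u t : ℝ)) (Set.Icc 0 1)
  initial : (u 0 : ℝ) = u₀
  equation : ∀ t ∈ Set.Icc (0 : ℝ) 1,
    s * (1 - 2 * t) * (u t : ℝ) * √(ff ((u t : ℝ) ^ 2)) + γ * t * ff ((u t : ℝ) ^ 2) +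
      γ * t * (u t : ℝ) ^ 2 * deriv ff ((u t : ℝ) ^ 2) = 0

theorem sq_le_two (u : Set.Icc (-√2) √2) : (u : ℝ) ^ 2 ≤ 2 := by
  have h : (u : ℝ) ^ 2 ≤ √2 ^ 2 := sq_le_sq' u.2.1 u.2.2
  rwa [Real.sq_sqrt (by norm_num)] at h

/-- `(0, u, √(2+u²), √(6+u²), √6, √(8-u²), √(4-u²), √(2-u²))`. -/
def pVec (u : ℝ) : C8 := fun k => ((![0, u, √(2 + u ^ 2), √(6 + u ^ 2), √6, √(8 - u ^ 2),
  √(4 - u ^ 2), √(2 - u ^ 2)] : Fin 8 → ℝ) k : ℝ)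

/-- `(√6, √(8-v²), √(4-v²), √(2-v²), 0, v, √(2+v²), √(6+v²))`. -/
def qVec (v : ℝ) : C8 := fun k => ((![√6, √(8 - v ^ 2), √(4 - v ^ 2), √(2 - v ^ 2), 0, v,
  √(2 + v ^ 2), √(6 + v ^ 2)] : Fin 8 → ℝ) k : ℝ)

theorem pVec_mem (u : Set.Icc (-√2) √2) : pVec u ∈ levelSet := by
  have h := sq_le_two u
  have h0 := sq_nonneg (u : ℝ)
  simp only [levelSet, Set.mem_ofPred_eq, pVec, Complex.norm_real, Real.norm_eq_abs, sq_abs,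
    Matrix.cons_val]
  rw [Real.sq_sqrt (by linarith), Real.sq_sqrt (by linarith), Real.sq_sqrt (by linarith),
    Real.sq_sqrt (by linarith), Real.sq_sqrt (by linarith), Real.sq_sqrt (by linarith)]
  refine ⟨?_, ?_, ?_, ?_, ?_, ?_⟩ <;> ring

theorem qVec_mem (v : Set.Icc (-√2) √2) : qVec v ∈ levelSet := by
  have h := sq_le_two v
  have h0 := sq_nonneg (v : ℝ)
  simp only [levelSet, Set.mem_ofPred_eq, qVec, Complex.norm_real, Real.norm_eq_abs, sq_abs,
    Matrix.cons_val]
  rw [Real.sq_sqrt (by linarith), Real.sq_sqrt (by linarith), Real.sq_sqrt (by linarith),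
    Real.sq_sqrt (by linarith), Real.sq_sqrt (by linarith), Real.sq_sqrt (by linarith)]
  refine ⟨?_, ?_, ?_, ?_, ?_, ?_⟩ <;> ring

/-- The point `[0, u, √(2+u²), √(6+u²), √6, √(8-u²), √(4-u²), √(2-u²)]` of `M`. -/
def pPoint (u : Set.Icc (-√2) √2) : M := toM ⟨pVec u, pVec_mem u⟩

/-- The point `[√6, √(8-v²), √(4-v²), √(2-v²), 0, v, √(2+v²), √(6+v²)]` of `M`. -/
def qPoint (v : Set.Icc (-√2) √2) : M := toM ⟨qVec v, qVec_mem v⟩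

end Octagon

end

/-! In the chart at a vertex of the octagon all coordinates of `lift` other than the two chart
coordinates are real, so the reduced form is the constant canonical one, `Omega0`. The functions J
and H become affine in a = |z_ν|² and b = |z_{ν+1}|², and X becomes x_{ν+1} times the square root of
a product of five affine functions that reduces to `ff b` on the edge a = 0. Hence J has Hessian
diag(2j, 2j, 0, 0), with j ≠ 0, at the points (0, 0, u, 0) of that edge. By evenness in the other
three coordinates, H_t has Hessian diag(k, k, m, n), and it is critical exactly when the derivative
of the one-variable function `phi` vanishes at u, which is the stated equation.

If m n > 0, the linearisations span all matrices with blocks proportional to Ω⁻¹ diag(1, 1) and Ω⁻¹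
diag(m, n). This is an abelian self-normalizing subalgebra (`blockSubalgebra_isCartan`), and its
regular elements have two pairs of imaginary eigenvalues. The sign of m n is the heart of the matter
(`edgeModel_critical`): eliminating 1 - 2t by the critical equation reduces it to 2 P P'' < P'² for
P(ζ) = ζ 𝔣(ζ) on [0, 2), a consequence of concavity (`concavity_inequality`). For t > 0 the equation
itself excludes u² = 2; at t = 0 the endpoints ±√2 are vertices and are treated in another chart.

For existence, P is symmetric about ζ = 1: with ζ = 1 + w one has P = (1 - w²)(9 - w²)(49 - w²).
Setting w = ± sin α turns the equation into the parallelism of (cos α, `height γ α`) with (t, 1 -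
2t). The polar angle of the first vector is a diffeomorphism of the line (`deriv_polar_pos`,
`polar_surjective`), so α is a smooth function of t. Half-angle formulas recover u without
square-root singularities at the ends (`exists_branches`), and v is obtained by reflection. -/

noncomputable section

namespace Octagon

/-! ### Linear algebra of the symplectic Lie algebra -/

attribute [local instance] LieRing.ofAssociativeRing

/-- The matrix of the symplectic form in canonical coordinates. -/
def Omega0 : Matrix (Fin 4) (Fin 4) ℝ := !![0, -1, 0, 0; 1, 0, 0, 0; 0, 0, 0, -1; 0, 0, 1, 0]

/-- `Ω⁻¹ diag(p, q, m, n)`. -/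
def blockMat (p q m n : ℝ) : Matrix (Fin 4) (Fin 4) ℝ :=
  !![0, q, 0, 0; -p, 0, 0, 0; 0, 0, 0, n; 0, 0, -m, 0]

theorem Omega0_inv : Omega0⁻¹ = -Omega0 := by
  apply Matrix.inv_eq_right_inv
  ext i j
  fin_cases i <;> fin_cases j <;> simp [Omega0, Matrix.mul_apply, Fin.sum_univ_four]

theorem Omega0_inv_mul_diagonal (p q m n : ℝ) :
    Omega0⁻¹ * Matrix.diagonal ![p, q, m, n] = blockMat p q m n := by
  rw [Omega0_inv]
  ext i j
  rw [Matrix.mul_diagonal]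
  fin_cases i <;> fin_cases j <;> simp [Omega0, blockMat]

theorem smul_blockMat_add (x y p q m n p' q' m' n' : ℝ) :
    x • blockMat p q m n + y • blockMat p' q' m' n' =
      blockMat (x * p + y * p') (x * q + y * q') (x * m + y * m') (x * n + y * n') := by
  ext i j
  fin_cases i <;> fin_cases j <;> simp [blockMat]
  all_goals ring

theorem mem_skewAdjoint_Omega0_iff (A : Matrix (Fin 4) (Fin 4) ℝ) :
    A ∈ skewAdjointMatricesLieSubalgebra Omega0 ↔ A.transpose * Omega0 = -(Omega0 * A) := by
  rw [mem_skewAdjointMatricesLieSubalgebra, mem_skewAdjointMatricesSubmodule,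
    Matrix.IsSkewAdjoint, Matrix.IsAdjointPair, mul_neg]

theorem blockMat_mem (p q m n : ℝ) :
    blockMat p q m n ∈ skewAdjointMatricesLieSubalgebra Omega0 := by
  rw [mem_skewAdjoint_Omega0_iff]
  ext i j
  fin_cases i <;> fin_cases j <;>
    simp [Omega0, blockMat, Matrix.mul_apply, Fin.sum_univ_four]

theorem blockMat_lie (x y x' y' p q m n : ℝ) :
    ⁅blockMat (x * p) (x * q) (y * m) (y * n), blockMat (x' * p) (x' * q) (y' * m) (y' * n)⁆ =
      0 := by
  rw [LieRing.of_associative_ring_bracket]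
  ext i j
  fin_cases i <;> fin_cases j <;>
    simp [blockMat]
  all_goals ring

/-- The abelian subalgebra of all `Ω⁻¹ diag(x p, x q, y m, y n)`. -/
def blockSubalgebra (p q m n : ℝ) :
    LieSubalgebra ℝ (skewAdjointMatricesLieSubalgebra Omega0) where
  carrier := {A | ∃ x y : ℝ, A.1 = blockMat (x * p) (x * q) (y * m) (y * n)}
  add_mem' := by
    rintro A B ⟨x, y, h⟩ ⟨x', y', h'⟩
    refine ⟨x + x', y + y', ?_⟩
    have := smul_blockMat_add 1 1 (x * p) (x * q) (y * m) (y * n) (x' * p) (x' * q) (y' * m)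
      (y' * n)
    simp only [one_smul, one_mul, ← add_mul] at this
    rw [← this, ← h, ← h']
    rfl
  zero_mem' := by
    refine ⟨0, 0, ?_⟩
    ext i j
    fin_cases i <;> fin_cases j <;> simp [blockMat]
  smul_mem' := by
    rintro c A ⟨x, y, h⟩
    refine ⟨c * x, c * y, ?_⟩
    have := smul_blockMat_add c 0 (x * p) (x * q) (y * m) (y * n) 0 0 0 0
    simp only [zero_smul, zero_mul, add_zero, ← mul_assoc] at this
    rw [← this, ← h]
    rfl
  lie_mem' := by
    rintro A B ⟨x, y, h⟩ ⟨x', y', h'⟩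
    refine ⟨0, 0, ?_⟩
    have e : (⁅A, B⁆ : skewAdjointMatricesLieSubalgebra Omega0).1 = ⁅A.1, B.1⁆ := rfl
    rw [e, h, h', blockMat_lie]
    ext i j
    fin_cases i <;> fin_cases j <;> simp [blockMat]

theorem mem_blockSubalgebra {p q m n : ℝ} {A : skewAdjointMatricesLieSubalgebra Omega0} :
    A ∈ blockSubalgebra p q m n ↔
      ∃ x y : ℝ, A.1 = blockMat (x * p) (x * q) (y * m) (y * n) := Iff.rfl

/-- This is self-normalization, tested on two generators. Each is invertible on one 2 × 2 block and
zero on the other, so the off-diagonal blocks of A vanish; within a block, a traceless matrix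
normalizing the line of an invertible generator commutes with it and is a multiple of it. -/
theorem eq_blockMat_of_lie_mem {p q m n : ℝ} (hp : p ≠ 0) (hq : q ≠ 0) (hm : m ≠ 0)
    (hn : n ≠ 0) {A : Matrix (Fin 4) (Fin 4) ℝ}
    (hA : A ∈ skewAdjointMatricesLieSubalgebra Omega0)
    (h1 : ∃ x y : ℝ, ⁅A, blockMat p q 0 0⁆ = blockMat (x * p) (x * q) (y * m) (y * n))
    (h2 : ∃ x y : ℝ, ⁅A, blockMat 0 0 m n⁆ = blockMat (x * p) (x * q) (y * m) (y * n)) :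
    ∃ x y : ℝ, A = blockMat (x * p) (x * q) (y * m) (y * n) := by
  rw [mem_skewAdjoint_Omega0_iff] at hA
  obtain ⟨x, y, h1⟩ := h1
  obtain ⟨x', y', h2⟩ := h2
  rw [LieRing.of_associative_ring_bracket] at h1 h2
  have eA := fun i j => congrFun (congrFun hA i) j
  have e1 := fun i j => congrFun (congrFun h1 i) j
  have e2 := fun i j => congrFun (congrFun h2 i) j
  simp only [Matrix.mul_apply, Matrix.sub_apply, Matrix.neg_apply, Fin.sum_univ_four,
    Matrix.transpose_apply] at eA e1 e2
  have a00 := eA 0 1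
  have a22 := eA 2 3
  have b00 := e1 0 0
  have b01 := e1 0 1
  have b10 := e1 1 0
  have b02 := e1 0 2
  have b03 := e1 0 3
  have b12 := e1 1 2
  have b13 := e1 1 3
  have b20 := e1 2 0
  have b21 := e1 2 1
  have b30 := e1 3 0
  have b31 := e1 3 1
  have c22 := e2 2 2
  have c23 := e2 2 3
  have c32 := e2 3 2
  simp [Omega0, blockMat] at a00 a22 b00 b01 b10 b02 b03 b12 b13 b20 b21 b30 b31 c22 c23 c32
  have d02 : A 0 2 = 0 := by simpa [hp] using b12
  have d03 : A 0 3 = 0 := by simpa [hp] using b13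
  have d12 : A 1 2 = 0 := by simpa [hq] using b02
  have d13 : A 1 3 = 0 := by simpa [hq] using b03
  have d20 : A 2 0 = 0 := by simpa [hq] using b21
  have d21 : A 2 1 = 0 := by simpa [hp] using b20
  have d30 : A 3 0 = 0 := by simpa [hq] using b31
  have d31 : A 3 1 = 0 := by simpa [hp] using b30
  have f11 : A 1 1 = -A 0 0 := by linarith
  have f33 : A 3 3 = -A 2 2 := by linarith
  rw [f11] at b01 b10
  rw [f33] at c23 c32
  -- The two off-diagonal entries of the bracket acquire opposite signs, so the factor x equals its
  -- own negative.
  have d00 : A 0 0 = 0 := by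
    have g1 : A 0 0 + A 0 0 = x := mul_right_cancel₀ hq (by linarith)
    have g2 : A 0 0 + A 0 0 = -x := mul_right_cancel₀ hp (by linarith)
    linarith
  have d22 : A 2 2 = 0 := by
    have g1 : A 2 2 + A 2 2 = y' := mul_right_cancel₀ hn (by linarith)
    have g2 : A 2 2 + A 2 2 = -y' := mul_right_cancel₀ hm (by linarith)
    linarith
  refine ⟨A 0 1 / q, A 2 3 / n, ?_⟩
  have k10 : A 1 0 = -(A 0 1 / q * p) := by field_simp; linarith
  have k32 : A 3 2 = -(A 2 3 / n * m) := by field_simp; linarith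
  ext i j
  fin_cases i <;> fin_cases j <;> simp [blockMat, *]

theorem blockSubalgebra_isCartan {p q m n : ℝ} (hp : p ≠ 0) (hq : q ≠ 0) (hm : m ≠ 0)
    (hn : n ≠ 0) : (blockSubalgebra p q m n).IsCartanSubalgebra where
  nilpotent := by
    have : IsLieAbelian (blockSubalgebra p q m n) := by
      refine ⟨fun A B => ?_⟩
      obtain ⟨x, y, h⟩ := mem_blockSubalgebra.1 A.2
      obtain ⟨x', y', h'⟩ := mem_blockSubalgebra.1 B.2
      apply Subtype.ext
      apply Subtype.ext
      have e : ((⁅A, B⁆ : blockSubalgebra p q m n).1).1 = ⁅A.1.1, B.1.1⁆ := rfl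
      rw [e, h, h', blockMat_lie]
      rfl
    infer_instance
  self_normalizing := by
    refine le_antisymm (fun A hA => ?_) (LieSubalgebra.le_normalizer _)
    rw [LieSubalgebra.mem_normalizer_iff] at hA
    refine mem_blockSubalgebra.2 (eq_blockMat_of_lie_mem hp hq hm hn A.2 ?_ ?_)
    · exact mem_blockSubalgebra.1 (hA ⟨_, blockMat_mem p q 0 0⟩
        (mem_blockSubalgebra.2 ⟨1, 0, by simp⟩))
    · exact mem_blockSubalgebra.1 (hA ⟨_, blockMat_mem 0 0 m n⟩
        (mem_blockSubalgebra.2 ⟨0, 1, by simp⟩))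

theorem mem_eigenvaluesC_blockMat (p q m n : ℝ) (z : ℂ) :
    z ∈ eigenvaluesC (blockMat p q m n) ↔ (z ^ 2 + p * q) * (z ^ 2 + m * n) = 0 := by
  rw [eigenvaluesC, spectrum.mem_iff, Matrix.isUnit_iff_isUnit_det, isUnit_iff_ne_zero, not_not]
  have : (algebraMap ℂ (Matrix (Fin 4) (Fin 4) ℂ) z - (blockMat p q m n).map Complex.ofReal).det
      = (z ^ 2 + p * q) * (z ^ 2 + m * n) := by
    have e : algebraMap ℂ (Matrix (Fin 4) (Fin 4) ℂ) z - (blockMat p q m n).map Complex.ofReal =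
        !![z, -q, 0, 0; p, z, 0, 0; 0, 0, z, -n; 0, 0, m, z] := by
      ext i j
      fin_cases i <;> fin_cases j <;> simp [blockMat, Matrix.algebraMap_matrix_apply]
    rw [e]
    simp [Matrix.det_succ_row_zero, Fin.sum_univ_succ, Fin.succAbove]
    ring
  rw [this]

theorem eigenvaluesC_blockMat {p q m n α β : ℝ} (h1 : p * q = α ^ 2) (h2 : m * n = β ^ 2) :
    eigenvaluesC (blockMat p q m n) =
      {α * Complex.I, -(α * Complex.I), β * Complex.I, -(β * Complex.I)} := by
  ext z
  rw [mem_eigenvaluesC_blockMat]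
  have h1' : (p : ℂ) * q = α ^ 2 := by exact_mod_cast h1
  have h2' : (m : ℂ) * n = β ^ 2 := by exact_mod_cast h2
  have e : (z ^ 2 + p * q) * (z ^ 2 + m * n) =
      ((z - α * Complex.I) * (z + α * Complex.I)) *
        ((z - β * Complex.I) * (z + β * Complex.I)) := by
    rw [h1', h2']
    linear_combination (-(z ^ 2 * (α ^ 2 + β ^ 2)) - α ^ 2 * β ^ 2 +
      α ^ 2 * β ^ 2 * Complex.I ^ 2) * (-Complex.I_sq)
  rw [e, mul_eq_zero, mul_eq_zero, mul_eq_zero, sub_eq_zero, sub_eq_zero, add_eq_zero_iff_eq_neg,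
    add_eq_zero_iff_eq_neg, or_assoc]
  rfl

theorem ncard_eigenvalues_le {α β : ℝ} (h : α = 0 ∨ β = 0 ∨ α = β) :
    ({α * Complex.I, -(α * Complex.I), β * Complex.I, -(β * Complex.I)} : Set ℂ).ncard ≤ 3 := by
  have key : ∀ a b c : ℂ, ({a, b, c} : Set ℂ).ncard ≤ 3 := fun a b c =>
    (Set.ncard_insert_le _ _).trans (Nat.succ_le_succ (Set.ncard_insert_le _ _ |>.trans
      (by simp)))
  rcases h with rfl | rfl | rfl
  · refine le_trans (Set.ncard_le_ncard ?_ (Set.toFinite _)) (key 0 (β * Complex.I)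
      (-(β * Complex.I)))
    intro z; simp
  · refine le_trans (Set.ncard_le_ncard ?_ (Set.toFinite _)) (key 0 (α * Complex.I)
      (-(α * Complex.I)))
    intro z; simp; tauto
  · refine le_trans (Set.ncard_le_ncard ?_ (Set.toFinite _)) (key 0 (α * Complex.I)
      (-(α * Complex.I)))
    intro z; simp; tauto

theorem isRegularElement_blockMat {p q m n : ℝ} (h1 : p * q = 1) (h2 : m * n = 4) :
    IsRegularElement (blockMat p q m n) := by
  rw [IsRegularElement, eigenvaluesC_blockMat (α := 1) (β := 2) (by linarith) (by linarith)]
  have hne : ∀ {z w : ℂ}, z.im ≠ w.im → z ≠ w := fun h e => h (by rw [e])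
  rw [Set.ncard_insert_of_notMem, Set.ncard_insert_of_notMem, Set.ncard_pair]
  · apply hne; norm_num
  · simp only [Set.mem_insert_iff, Set.mem_singleton_iff, not_or]
    constructor <;> apply hne <;> norm_num
  · simp only [Set.mem_insert_iff, Set.mem_singleton_iff, not_or]
    refine ⟨?_, ?_, ?_⟩ <;> apply hne <;> norm_num

/-- Non-strict signs suffice: a vanishing or repeated frequency would leave at most three
eigenvalues. -/
theorem ellipticElliptic_of_regular {p q m n : ℝ} (h1 : 0 ≤ p * q) (h2 : 0 ≤ m * n)
    (hr : IsRegularElement (blockMat p q m n)) :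
    HasEllipticEllipticEigenvalues (blockMat p q m n) := by
  have e := eigenvaluesC_blockMat (Real.sq_sqrt h1).symm (Real.sq_sqrt h2).symm
  have hcard : ¬ (√(p * q) = 0 ∨ √(m * n) = 0 ∨ √(p * q) = √(m * n)) := by
    intro h
    have := ncard_eigenvalues_le h
    rw [← e] at this
    rw [IsRegularElement] at hr
    omega
  push Not at hcard
  exact ⟨_, _, (Real.sqrt_nonneg _).lt_of_ne' hcard.1, (Real.sqrt_nonneg _).lt_of_ne' hcard.2.1,
    hcard.2.2, e⟩

theorem isEllipticElliptic_of_linSpan {f g : M → ℝ} {ν : Fin 8} (x : V ν)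
    {p q m n : ℝ} (hpq : 0 < p * q) (hmn : 0 < m * n) (hΩ : omega ν x = Omega0)
    (hfix : IsFixedAt f g ν x)
    (hspan : ∀ A, A ∈ linSpan f g ν x ↔
      ∃ s t : ℝ, A = blockMat (s * p) (s * q) (t * m) (t * n)) :
    IsEllipticElliptic f g (param ν x) := by
  refine ⟨ν, x, rfl, hfix, ?_, ?_, ?_⟩
  · unfold SpansCartan
    rw [hΩ]
    refine ⟨blockSubalgebra p q m n, blockSubalgebra_isCartan (left_ne_zero_of_mul hpq.ne')
      (right_ne_zero_of_mul hpq.ne') (left_ne_zero_of_mul hmn.ne')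
      (right_ne_zero_of_mul hmn.ne'), fun A => ?_⟩
    rw [hspan]
    constructor
    · rintro ⟨s, t, rfl⟩
      exact ⟨blockMat_mem _ _ _ _, s, t, rfl⟩
    · rintro ⟨hA, s, t, h⟩
      exact ⟨s, t, h⟩
  -- The scaling makes the block frequencies 1 and 2, so the spectrum is {±i, ±2i}.
  · refine ⟨_, (hspan _).2 ⟨1 / √(p * q), 2 / √(m * n), rfl⟩, isRegularElement_blockMat ?_ ?_⟩
    · have := Real.sq_sqrt hpq.le
      have := (Real.sqrt_pos.2 hpq).ne'
      field_simp
      linarith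
    · have := Real.sq_sqrt hmn.le
      have := (Real.sqrt_pos.2 hmn).ne'
      field_simp
      linarith
  · intro C hC hr
    obtain ⟨s, t, rfl⟩ := (hspan _).1 hC
    refine ellipticElliptic_of_regular ?_ ?_ hr
    · have : s * p * (s * q) = s ^ 2 * (p * q) := by ring
      rw [this]; positivity
    · have : t * m * (t * n) = t ^ 2 * (m * n) := by ring
      rw [this]; positivity

/-! ### The charts -/

theorem contDiff_sqAt (ν k : Fin 8) {n : WithTop ℕ∞} : ContDiff ℝ n (fun y => sqAt ν y k) := by
  unfold sqAt sqMod
  fun_prop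

theorem isOpen_V (ν : Fin 8) : IsOpen (V ν) := by
  have : V ν = ⋂ k : Fin 8, {x | k ≠ ν → k ≠ ν + 1 → 0 < sqAt ν x k} := by
    ext x; simp [V]
  rw [this]
  refine isOpen_iInter_of_finite fun k => ?_
  by_cases h1 : k = ν
  · simp [h1]
  by_cases h2 : k = ν + 1
  · simp [h2]
  · simpa [h1, h2] using isOpen_lt continuous_const (contDiff_sqAt ν k (n := 0)).continuous

theorem succ_ne_self (ν : Fin 8) : ν + 1 ≠ ν := by
  revert ν; decide

theorem lift_self (ν : Fin 8) (y : Fin 4 → ℝ) : lift ν y ν = ⟨y 0, y 1⟩ := by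
  simp [lift]

theorem lift_succ (ν : Fin 8) (y : Fin 4 → ℝ) : lift ν y (ν + 1) = ⟨y 2, y 3⟩ := by
  simp [lift]

theorem lift_of_ne {ν k : Fin 8} (h1 : k ≠ ν) (h2 : k ≠ ν + 1) (y : Fin 4 → ℝ) :
    lift ν y k = (√(sqAt ν y k) : ℝ) := by
  simp [lift, h1, h2]

theorem hasFDerivAt_mk (i j : Fin 4) (x : Fin 4 → ℝ) :
    HasFDerivAt (fun y : Fin 4 → ℝ => (⟨y i, y j⟩ : ℂ))
      (Complex.equivRealProdCLM.symm.toContinuousLinearMap.comp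
        ((ContinuousLinearMap.proj (R := ℝ) (φ := fun _ : Fin 4 => ℝ) i).prod
          (ContinuousLinearMap.proj (R := ℝ) (φ := fun _ : Fin 4 => ℝ) j))) x :=
  ContinuousLinearMap.hasFDerivAt (Complex.equivRealProdCLM.symm.toContinuousLinearMap.comp
        ((ContinuousLinearMap.proj (R := ℝ) (φ := fun _ : Fin 4 => ℝ) i).prod
          (ContinuousLinearMap.proj (R := ℝ) (φ := fun _ : Fin 4 => ℝ) j)))

theorem hasFDerivAt_lift_of_ne {ν k : Fin 8} (h1 : k ≠ ν) (h2 : k ≠ ν + 1) {x : Fin 4 → ℝ}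
    (hx : x ∈ V ν) :
    HasFDerivAt (fun y => lift ν y k)
      (Complex.ofRealCLM.comp (fderiv ℝ (fun y => √(sqAt ν y k)) x)) x := by
  simp only [lift_of_ne h1 h2]
  have h : DifferentiableAt ℝ (fun y => √(sqAt ν y k)) x :=
    ((contDiff_sqAt ν k (n := 1)).differentiable (by norm_num) x).sqrt (hx k h1 h2).ne'
  exact Complex.ofRealCLM.hasFDerivAt.comp x h.hasFDerivAt

theorem differentiableAt_lift {ν : Fin 8} {x : Fin 4 → ℝ} (hx : x ∈ V ν) (k : Fin 8) :
    DifferentiableAt ℝ (fun y => lift ν y k) x := by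
  by_cases h1 : k = ν
  · subst h1
    simp only [lift_self]
    exact (hasFDerivAt_mk 0 1 x).differentiableAt
  by_cases h2 : k = ν + 1
  · subst h2
    simp only [lift_succ]
    exact (hasFDerivAt_mk 2 3 x).differentiableAt
  · exact (hasFDerivAt_lift_of_ne h1 h2 hx).differentiableAt

/-- Only the coordinates ν and ν + 1 contribute: the others are real along the section, and the form
vanishes on pairs of real numbers. -/
theorem omegaStd_fderiv_lift {ν : Fin 8} {x : Fin 4 → ℝ} (hx : x ∈ V ν) (v w : Fin 4 → ℝ) :
    omegaStd (fderiv ℝ (lift ν) x v) (fderiv ℝ (lift ν) x w) =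
      (v 1 * w 0 - v 0 * w 1) + (v 3 * w 2 - v 2 * w 3) := by
  have hk : ∀ k u, fderiv ℝ (lift ν) x u k = fderiv ℝ (fun y => lift ν y k) x u := by
    intro k u
    have : lift ν = fun y k => lift ν y k := rfl
    rw [this, fderiv_pi (differentiableAt_lift hx)]
    rfl
  have h0 : ∀ u, fderiv ℝ (lift ν) x u ν = ⟨u 0, u 1⟩ := by
    intro u
    rw [hk]
    simp only [lift_self]
    rw [(hasFDerivAt_mk 0 1 x).fderiv]
    rfl
  have h1 : ∀ u, fderiv ℝ (lift ν) x u (ν + 1) = ⟨u 2, u 3⟩ := by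
    intro u
    rw [hk]
    simp only [lift_succ]
    rw [(hasFDerivAt_mk 2 3 x).fderiv]
    rfl
  have h2 : ∀ k u, k ≠ ν → k ≠ ν + 1 → (fderiv ℝ (lift ν) x u k).im = 0 := by
    intro k u e1 e2
    rw [hk, (hasFDerivAt_lift_of_ne e1 e2 hx).fderiv]
    simp
  rw [omegaStd, Fintype.sum_eq_add ν (ν + 1) (succ_ne_self ν).symm]
  · simp only [h0, h1]
  · rintro k ⟨e1, e2⟩
    simp [h2 k _ e1 e2]

theorem omega_eq {ν : Fin 8} {x : Fin 4 → ℝ} (hx : x ∈ V ν) :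
    omega ν x = !![0, -1, 0, 0; 1, 0, 0, 0; 0, 0, 0, -1; 0, 0, 1, 0] := by
  ext i j
  rw [omega, Matrix.of_apply, omegaStd_fderiv_lift hx]
  fin_cases i <;> fin_cases j <;> simp

/-! ### Coordinate representations -/

theorem localRep_of_mem {f : M → ℝ} {ν : Fin 8} {y : Fin 4 → ℝ} (hy : y ∈ V ν) :
    localRep f ν y = f (param ν ⟨y, hy⟩) := by
  simp [localRep, hy]

theorem J_param {ν : Fin 8} (y : V ν) : J (param ν y) = sqAt ν y.1 0 / 2 := by
  have : J (param ν y) = ‖lift ν y.1 0‖ ^ 2 / 2 := rfl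
  rw [this, norm_lift_sq y.2]

theorem H_param {ν : Fin 8} (y : V ν) : H (param ν y) = sqAt ν y.1 2 / 2 := by
  have : H (param ν y) = ‖lift ν y.1 2‖ ^ 2 / 2 := rfl
  rw [this, norm_lift_sq y.2]

theorem X_param {ν : Fin 8} (y : V ν) : X (param ν y) = (Zfun (lift ν y.1)).re := rfl

theorem sqrt_mul_five {a b c d e : ℝ} (ha : 0 ≤ a) (hb : 0 ≤ b) (hc : 0 ≤ c) (hd : 0 ≤ d) :
    √(a * b * c * d * e) = √a * √b * √c * √d * √e := by
  rw [Real.sqrt_mul (by positivity), Real.sqrt_mul (by positivity), Real.sqrt_mul (by positivity),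
    Real.sqrt_mul ha]

theorem X_param_zero (y : V 0) : X (param 0 y) = y.1 2 *
    √(sqAt 0 y.1 2 * sqAt 0 y.1 3 * sqAt 0 y.1 5 * sqAt 0 y.1 6 * sqAt 0 y.1 7) := by
  have h := y.2
  rw [X_param, sqrt_mul_five (h 2 (by decide) (by decide)).le (h 3 (by decide) (by decide)).le
    (h 5 (by decide) (by decide)).le (h 6 (by decide) (by decide)).le]
  have e : lift 0 y.1 1 = ⟨y.1 2, y.1 3⟩ := lift_succ 0 y.1
  rw [Zfun, e, lift_of_ne (k := 2) (by decide) (by decide), lift_of_ne (k := 3) (by decide)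
    (by decide), lift_of_ne (k := 5) (by decide) (by decide), lift_of_ne (k := 6) (by decide)
    (by decide), lift_of_ne (k := 7) (by decide) (by decide)]
  simp only [Complex.conj_ofReal, Complex.mul_re, Complex.mul_im, Complex.ofReal_re,
    Complex.ofReal_im, Complex.conj_re, Complex.conj_im]
  ring

theorem X_param_four (y : V 4) : X (param 4 y) = y.1 2 *
    √(sqAt 4 y.1 1 * sqAt 4 y.1 2 * sqAt 4 y.1 3 * sqAt 4 y.1 6 * sqAt 4 y.1 7) := by
  have h := y.2
  rw [X_param, sqrt_mul_five (h 1 (by decide) (by decide)).le (h 2 (by decide) (by decide)).le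
    (h 3 (by decide) (by decide)).le (h 6 (by decide) (by decide)).le]
  have e : lift 4 y.1 5 = ⟨y.1 2, y.1 3⟩ := lift_succ 4 y.1
  rw [Zfun, e, lift_of_ne (k := 2) (by decide) (by decide), lift_of_ne (k := 3) (by decide)
    (by decide), lift_of_ne (k := 1) (by decide) (by decide), lift_of_ne (k := 6) (by decide)
    (by decide), lift_of_ne (k := 7) (by decide) (by decide)]
  simp only [Complex.conj_ofReal, Complex.mul_re, Complex.mul_im, Complex.ofReal_re,
    Complex.ofReal_im]
  ring

/-! ### Identification of the points -/

theorem sqrt_two_mul_sqrt_three : √2 * √3 = √6 := by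
  rw [← Real.sqrt_mul (by norm_num)]; norm_num

theorem toM_eq {z w : levelSet} (h : z.1 = w.1) : toM z = toM w := by
  rw [Subtype.ext h]

theorem mem_V_zero {u : ℝ} (hu : u ^ 2 < 2) : ![0, 0, u, 0] ∈ V 0 := by
  have := sq_nonneg u
  intro k
  fin_cases k <;> simp [sqAt, sqMod, det2, normal, offset] <;> linarith

theorem mem_V_four {u : ℝ} (hu : u ^ 2 < 2) : ![0, 0, u, 0] ∈ V 4 := by
  have := sq_nonneg u
  intro k
  fin_cases k <;> simp [sqAt, sqMod, det2, normal, offset] <;> linarith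

theorem mem_V_seven : ![0, 0, 0, 0] ∈ V 7 := by
  intro k
  fin_cases k <;> simp [sqAt, sqMod, det2, normal, offset] <;> norm_num

theorem mem_V_three : ![0, 0, 0, 0] ∈ V 3 := by
  intro k
  fin_cases k <;> simp [sqAt, sqMod, det2, normal, offset] <;> norm_num

theorem param_zero (u : Set.Icc (-√2) √2) (hu : (u : ℝ) ^ 2 < 2) :
    param 0 ⟨![0, 0, u, 0], mem_V_zero hu⟩ = pPoint u := by
  apply toM_eq
  funext k
  fin_cases k <;> simp [lift, pVec, sqAt, sqMod, det2, normal, offset, Complex.ext_iff,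
    sqrt_two_mul_sqrt_three] <;> ring_nf

theorem param_four (v : Set.Icc (-√2) √2) (hv : (v : ℝ) ^ 2 < 2) :
    param 4 ⟨![0, 0, v, 0], mem_V_four hv⟩ = qPoint v := by
  apply toM_eq
  funext k
  fin_cases k <;> simp [lift, qVec, sqAt, sqMod, det2, normal, offset, Complex.ext_iff,
    sqrt_two_mul_sqrt_three] <;> ring_nf

theorem param_seven (u : Set.Icc (-√2) √2) (hu : (u : ℝ) = √2) :
    param 7 ⟨![0, 0, 0, 0], mem_V_seven⟩ = pPoint u := by
  apply toM_eq
  funext k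
  fin_cases k <;> simp [lift, pVec, sqAt, sqMod, det2, normal, offset, Complex.ext_iff, hu,
    sqrt_two_mul_sqrt_three] <;>
    norm_num

theorem param_three (v : Set.Icc (-√2) √2) (hv : (v : ℝ) = -√2) :
    param 3 ⟨![0, 0, 0, 0], mem_V_three⟩ = qPoint v := by
  -- The section has z₆ = √2 where `qVec` has -√2. Rotating by θ₅ = π flips z₆; θ₄ = π restores z₇
  -- and otherwise only moves z₄ and z₅, which are zero here.
  refine Quotient.sound ⟨![0, 0, 0, Real.pi, Real.pi, 0], ?_⟩
  funext k
  fin_cases k <;> simp [rotate, angle, lift, qVec, sqAt, sqMod, det2, normal, offset,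
    Complex.ext_iff, hv, sqrt_two_mul_sqrt_three] <;> norm_num

open Filter Topology

/-! ### Second derivatives along lines -/

section Lines

variable {E : Type*} [NormedAddCommGroup E] [NormedSpace ℝ E] {f : E → ℝ} {x : E}

theorem hasDerivAt_line (x v : E) (s : ℝ) : HasDerivAt (fun s : ℝ => x + s • v) v s := by
  simpa using ((hasDerivAt_id s).smul_const v).const_add x

theorem deriv_line (hf : DifferentiableAt ℝ f x) (v : E) :
    deriv (fun s : ℝ => f (x + s • v)) 0 = fderiv ℝ f x v := by
  have h : HasFDerivAt f (fderiv ℝ f x) (x + (0 : ℝ) • v) := by simpa using hf.hasFDerivAt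
  exact (h.comp_hasDerivAt 0 (hasDerivAt_line x v 0)).deriv

theorem deriv_deriv_line (hf : ContDiffAt ℝ 2 f x) (v : E) :
    deriv (deriv fun s : ℝ => f (x + s • v)) 0 = fderiv ℝ (fderiv ℝ f) x v v := by
  have hev : ∀ᶠ y in 𝓝 x, DifferentiableAt ℝ f y :=
    (hf.eventually (by simp)).mono fun y hy => hy.differentiableAt (by simp)
  have ht : Tendsto (fun s : ℝ => x + s • v) (𝓝 0) (𝓝 x) := by
    simpa [ContinuousAt] using (hasDerivAt_line x v 0).continuousAt
  have h1 : deriv (fun s : ℝ => f (x + s • v)) =ᶠ[𝓝 0] fun s => fderiv ℝ f (x + s • v) v := by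
    filter_upwards [ht.eventually hev] with s hs
    exact (hs.hasFDerivAt.comp_hasDerivAt s (hasDerivAt_line x v s)).deriv
  rw [h1.deriv_eq]
  have hd : DifferentiableAt ℝ (fderiv ℝ f) x :=
    (hf.fderiv_right (m := 1) (by norm_num)).differentiableAt (by simp)
  have h2 : HasFDerivAt (fderiv ℝ f) (fderiv ℝ (fderiv ℝ f) x) (x + (0 : ℝ) • v) := by
    simpa using hd.hasFDerivAt
  have h3 := h2.comp_hasDerivAt 0 (hasDerivAt_line x v 0)
  exact (h3.clm_apply (hasDerivAt_const 0 v)).deriv.trans (by simp)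

/-- Polarization: the values of the symmetric form at v + w and at v - w differ by four times its
value at (v, w). -/
theorem fderiv_fderiv_eq_zero_of_line (hf : ContDiffAt ℝ 2 f x) {v w : E}
    (h : ∀ s : ℝ, f (x + s • (v + w)) = f (x + s • (v - w))) :
    fderiv ℝ (fderiv ℝ f) x v w = 0 := by
  have hs : fderiv ℝ (fderiv ℝ f) x v w = fderiv ℝ (fderiv ℝ f) x w v :=
    (hf.isSymmSndFDerivAt (by simp)) v w
  have h1 := deriv_deriv_line hf (v + w)
  have h2 := deriv_deriv_line hf (v - w)
  rw [show (fun s : ℝ => f (x + s • (v + w))) = fun s => f (x + s • (v - w)) from funext h, h2]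
    at h1
  simp only [map_add, map_sub, add_apply, sub_apply] at h1
  linarith

end Lines

theorem deriv_deriv_eq_of_hasDerivAt {g g' : ℝ → ℝ} {c x : ℝ}
    (h : ∀ᶠ s in 𝓝 x, HasDerivAt g (g' s) s) (h' : HasDerivAt g' c x) :
    deriv (deriv g) x = c := by
  have : deriv g =ᶠ[𝓝 x] g' := h.mono fun s hs => hs.deriv
  rw [this.deriv_eq, h'.deriv]

/-- The Hessian at `(0, 0, u, 0)` of a function of `x₀² + x₁²`, `x₂` and `x₃²` is diagonal. -/
theorem hessian_eq_diagonal {G : (Fin 4 → ℝ) → ℝ} {Φ : ℝ → ℝ → ℝ → ℝ}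
    (hG : ∀ y, G y = Φ (y 0 ^ 2 + y 1 ^ 2) (y 2) (y 3 ^ 2)) {u : ℝ}
    (hf : ContDiffAt ℝ 2 G ![0, 0, u, 0]) {k m n : ℝ}
    (hk : deriv (deriv fun s => Φ (s ^ 2) u 0) 0 = k)
    (hm : deriv (deriv fun s => Φ 0 (u + s) 0) 0 = m)
    (hn : deriv (deriv fun s => Φ 0 u (s ^ 2)) 0 = n) :
    (Matrix.of fun i j => fderiv ℝ (fderiv ℝ G) ![0, 0, u, 0] (Pi.single i 1) (Pi.single j 1)) =
      Matrix.diagonal ![k, k, m, n] := by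
  -- The reflection of coordinate j fixes the base point and preserves G, so the lines in directions
  -- e_i + e_j and e_i - e_j give the same values.
  have hoff : ∀ i j : Fin 4, j ≠ i → j ≠ 2 →
      fderiv ℝ (fderiv ℝ G) ![0, 0, u, 0] (Pi.single i 1) (Pi.single j 1) = 0 := by
    intro i j hij hj
    apply fderiv_fderiv_eq_zero_of_line hf
    intro s
    rw [hG, hG]
    fin_cases i <;> fin_cases j <;> simp at hij hj ⊢
  have hsymm : ∀ v w, fderiv ℝ (fderiv ℝ G) ![0, 0, u, 0] v w =
      fderiv ℝ (fderiv ℝ G) ![0, 0, u, 0] w v := fun v w =>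
    (hf.isSymmSndFDerivAt (by simp)) v w
  ext i j
  rw [Matrix.of_apply]
  by_cases hij : i = j
  · subst hij
    rw [Matrix.diagonal_apply_eq, ← deriv_deriv_line hf]
    simp only [hG]
    fin_cases i
    · simpa using hk
    · simpa using hk
    · simpa using hm
    · simpa using hn
  · rw [Matrix.diagonal_apply_ne _ hij]
    by_cases hj : j = 2
    · rw [hsymm]
      exact hoff j i hij (fun h => hij (h.trans hj.symm))
    · exact hoff i j (Ne.symm hij) hj

theorem fderiv_eq_zero {G : (Fin 4 → ℝ) → ℝ} {Φ : ℝ → ℝ → ℝ → ℝ}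
    (hG : ∀ y, G y = Φ (y 0 ^ 2 + y 1 ^ 2) (y 2) (y 3 ^ 2)) {u : ℝ}
    (hf : DifferentiableAt ℝ G ![0, 0, u, 0]) (hu : deriv (fun s => Φ 0 (u + s) 0) 0 = 0) :
    fderiv ℝ G ![0, 0, u, 0] = 0 := by
  have key : ∀ i : Fin 4, fderiv ℝ G ![0, 0, u, 0] (Pi.single i 1) = 0 := by
    intro i
    by_cases hi : i = 2
    · subst hi
      rw [← deriv_line hf]
      simp only [hG]
      simpa using hu
    -- G is even in every coordinate other than the third, so this partial derivative equals its
    -- negative.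
    · have h1 := deriv_line hf (Pi.single i 1)
      have h2 := deriv_line hf (-Pi.single i 1)
      have : (fun s : ℝ => G (![0, 0, u, 0] + s • Pi.single i 1)) =
          fun s => G (![0, 0, u, 0] + s • (-Pi.single i 1)) := by
        funext s
        rw [hG, hG]
        fin_cases i <;> simp at hi ⊢
      rw [this, h2, map_neg] at h1
      linarith
  apply ContinuousLinearMap.coe_injective
  exact (Pi.basisFun ℝ (Fin 4)).ext fun i => by simpa using key i

/-! ### Two model functions -/

/-- Affine functions of `|z_ν|²` and `|z_{ν+1}|²`. -/
def affineModel (κ₀ κ₁ κ₂ : ℝ) (y : Fin 4 → ℝ) : ℝ :=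
  κ₀ + κ₁ * (y 0 ^ 2 + y 1 ^ 2) + κ₂ * (y 2 ^ 2 + y 3 ^ 2)

theorem contDiff_affineModel (κ₀ κ₁ κ₂ : ℝ) {n : WithTop ℕ∞} :
    ContDiff ℝ n (affineModel κ₀ κ₁ κ₂) := by
  unfold affineModel
  fun_prop

theorem deriv_deriv_quadratic (a b c : ℝ) (x : ℝ) :
    deriv (deriv fun s : ℝ => a + b * (c + s) ^ 2) x = 2 * b := by
  refine deriv_deriv_eq_of_hasDerivAt (g' := fun s => 2 * b * (c + s))
    (Eventually.of_forall fun s => ?_) ?_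
  · have := ((((hasDerivAt_id s).const_add c).pow 2).const_mul b).const_add a
    refine HasDerivAt.congr_deriv this ?_
    simp; ring
  · simpa using ((hasDerivAt_id x).const_add c).const_mul (2 * b)

theorem hessian_affineModel (κ₀ κ₁ κ₂ u : ℝ) :
    (Matrix.of fun i j => fderiv ℝ (fderiv ℝ (affineModel κ₀ κ₁ κ₂)) ![0, 0, u, 0]
      (Pi.single i 1) (Pi.single j 1)) =
      Matrix.diagonal ![2 * κ₁, 2 * κ₁, 2 * κ₂, 2 * κ₂] := by
  refine hessian_eq_diagonal (Φ := fun a x c => κ₀ + κ₁ * a + κ₂ * (x ^ 2 + c))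
    (fun y => rfl) (contDiff_affineModel _ _ _).contDiffAt ?_ ?_ ?_
  · convert deriv_deriv_quadratic (κ₀ + κ₂ * u ^ 2) κ₁ 0 0 using 4
    ring
  · convert deriv_deriv_quadratic κ₀ κ₂ u 0 using 4
    ring
  · convert deriv_deriv_quadratic (κ₀ + κ₂ * u ^ 2) κ₂ 0 0 using 4
    ring

theorem fderiv_affineModel {κ₀ κ₁ κ₂ u : ℝ} (h : κ₂ * u = 0) :
    fderiv ℝ (affineModel κ₀ κ₁ κ₂) ![0, 0, u, 0] = 0 := by
  refine fderiv_eq_zero (Φ := fun a x c => κ₀ + κ₁ * a + κ₂ * (x ^ 2 + c)) (fun y => rfl)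
    ((contDiff_affineModel _ _ _ (n := 1)).differentiable (by simp) _) ?_
  have e := (((((hasDerivAt_id (0 : ℝ)).const_add u).pow 2).add_const 0).const_mul κ₂).const_add
    (κ₀ + κ₁ * 0)
  refine e.deriv.trans ?_
  simp only [id, Nat.cast_ofNat, Nat.add_one_sub_one, pow_one]
  linear_combination 2 * h

/-! ### The polynomial 𝔣 and the one-variable reduced Hamiltonian -/

theorem ff_eq (ζ : ℝ) :
    ff ζ = 768 - 160 * ζ - 216 * ζ ^ 2 + 44 * ζ ^ 3 + 6 * ζ ^ 4 - ζ ^ 5 := by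
  unfold ff; ring

theorem hasDerivAt_ff (ζ : ℝ) :
    HasDerivAt ff (-160 - 432 * ζ + 132 * ζ ^ 2 + 24 * ζ ^ 3 - 5 * ζ ^ 4) ζ := by
  have e : ff = fun ζ => 768 - 160 * ζ - 216 * ζ ^ 2 + 44 * ζ ^ 3 + 6 * ζ ^ 4 - ζ ^ 5 :=
    funext ff_eq
  rw [e]
  have := (((((hasDerivAt_id ζ).const_mul 160).const_sub 768).sub
    (((hasDerivAt_id ζ).pow 2).const_mul 216)).add (((hasDerivAt_id ζ).pow 3).const_mul 44)).add
    (((hasDerivAt_id ζ).pow 4).const_mul 6) |>.sub ((hasDerivAt_id ζ).pow 5)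
  refine HasDerivAt.congr_deriv this ?_
  simp; ring

theorem deriv_ff :
    deriv ff = fun ζ => -160 - 432 * ζ + 132 * ζ ^ 2 + 24 * ζ ^ 3 - 5 * ζ ^ 4 :=
  funext fun ζ => (hasDerivAt_ff ζ).deriv

theorem hasDerivAt_deriv_ff (ζ : ℝ) :
    HasDerivAt (deriv ff) (-432 + 264 * ζ + 72 * ζ ^ 2 - 20 * ζ ^ 3) ζ := by
  rw [deriv_ff]
  have := (((((hasDerivAt_id ζ).const_mul 432).const_sub (-160)).add
    (((hasDerivAt_id ζ).pow 2).const_mul 132)).add (((hasDerivAt_id ζ).pow 3).const_mul 24)).sub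
    (((hasDerivAt_id ζ).pow 4).const_mul 5)
  refine HasDerivAt.congr_deriv this ?_
  simp; ring

theorem continuous_ff : Continuous ff :=
  continuous_iff_continuousAt.2 fun ζ => (hasDerivAt_ff ζ).continuousAt

theorem ff_pos {ζ : ℝ} (h0 : 0 ≤ ζ) (h2 : ζ < 2) : 0 < ff ζ := by
  unfold ff
  have := sub_pos.2 h2
  have : 0 < 8 - ζ := by linarith
  have : 0 < 4 - ζ := by linarith
  positivity

/-- `2 P P'' < P'²` for `P(ζ) = ζ 𝔣(ζ)` on `[0, 2)`, since `P` is concave there. -/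
theorem concavity_inequality {ζ : ℝ} (h0 : 0 ≤ ζ) (h2 : ζ < 2) :
    2 * ζ * ff ζ * (2 * deriv ff ζ + ζ * (-432 + 264 * ζ + 72 * ζ ^ 2 - 20 * ζ ^ 3)) <
      (ff ζ + ζ * deriv ff ζ) ^ 2 := by
  have hf := ff_pos h0 h2
  have hc : 2 * deriv ff ζ + ζ * (-432 + 264 * ζ + 72 * ζ ^ 2 - 20 * ζ ^ 3) < 0 := by
    rw [deriv_ff]
    -- P'' is even about ζ = 1, as P is; on [0, 2] it is at most -998 + 708.
    have hw : (ζ - 1) ^ 2 ≤ 1 := by nlinarith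
    have : 2 * (-160 - 432 * ζ + 132 * ζ ^ 2 + 24 * ζ ^ 3 - 5 * ζ ^ 4) +
      ζ * (-432 + 264 * ζ + 72 * ζ ^ 2 - 20 * ζ ^ 3) =
        -998 + 708 * (ζ - 1) ^ 2 - 30 * ((ζ - 1) ^ 2) ^ 2 := by ring
    simp only [this]
    nlinarith [sq_nonneg ((ζ - 1) ^ 2)]
  rcases h0.eq_or_lt with rfl | h0
  · simp only [mul_zero, zero_mul, add_zero]
    positivity
  · refine lt_of_lt_of_le (mul_neg_of_pos_of_neg (by positivity) hc) (sq_nonneg _)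

/-- The reduced Hamiltonian on the meridian. -/
def phi (C τ x : ℝ) : ℝ := C / 2 * x ^ 2 + τ * (x * √(ff (x ^ 2)))

/-- The derivative of `phi`. -/
def phi' (C τ x : ℝ) : ℝ :=
  C * x + τ * (√(ff (x ^ 2)) + x ^ 2 * deriv ff (x ^ 2) / √(ff (x ^ 2)))

theorem hasDerivAt_comp_sq {F : ℝ → ℝ} {F' x : ℝ} (h : HasDerivAt F F' (x ^ 2)) :
    HasDerivAt (fun y => F (y ^ 2)) (F' * (2 * x)) x := by
  have := HasDerivAt.comp (h₂ := F) (h := fun y : ℝ => y ^ 2) x h (hasDerivAt_pow 2 x)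
  refine HasDerivAt.congr_deriv this ?_
  simp

theorem hasDerivAt_sqrt_ff_sq {x : ℝ} (h : 0 < ff (x ^ 2)) :
    HasDerivAt (fun y => √(ff (y ^ 2))) (deriv ff (x ^ 2) * x / √(ff (x ^ 2))) x := by
  have h1 := (hasDerivAt_comp_sq (hasDerivAt_ff (x ^ 2)).differentiableAt.hasDerivAt).sqrt h.ne'
  refine HasDerivAt.congr_deriv h1 ?_
  have := (Real.sqrt_pos.2 h).ne'
  field_simp

theorem hasDerivAt_phi (C τ : ℝ) {x : ℝ} (h : 0 < ff (x ^ 2)) :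
    HasDerivAt (phi C τ) (phi' C τ x) x := by
  have h1 := ((hasDerivAt_pow 2 x).const_mul (C / 2)).add
    (((hasDerivAt_id x).mul (hasDerivAt_sqrt_ff_sq h)).const_mul τ)
  refine HasDerivAt.congr_deriv h1 ?_
  simp [phi']
  ring

theorem hasDerivAt_phi' (C τ : ℝ) {x : ℝ} (h : 0 < ff (x ^ 2)) :
    HasDerivAt (phi' C τ) (C + τ * (3 * x * deriv ff (x ^ 2) / √(ff (x ^ 2)) +
      2 * x ^ 3 * (-432 + 264 * x ^ 2 + 72 * (x ^ 2) ^ 2 - 20 * (x ^ 2) ^ 3) / √(ff (x ^ 2)) -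
      x ^ 3 * deriv ff (x ^ 2) ^ 2 / √(ff (x ^ 2)) ^ 3)) x := by
  have hs := (Real.sqrt_pos.2 h).ne'
  have h1 := ((hasDerivAt_id x).const_mul C).add (((hasDerivAt_sqrt_ff_sq h).add
    (((hasDerivAt_pow 2 x).mul (hasDerivAt_comp_sq (hasDerivAt_deriv_ff (x ^ 2)))).div
      (hasDerivAt_sqrt_ff_sq h) hs)).const_mul τ)
  refine HasDerivAt.congr_deriv h1 ?_
  simp only [Pi.mul_apply, Nat.cast_ofNat, Nat.add_one_sub_one, pow_one]
  field_simp
  ring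

/-- The coordinate representation of `H_t` near the interior of an edge of the octagon. -/
def edgeModel (Ψ : ℝ → ℝ → ℝ) (κ₀ κ₁ C τ : ℝ) (y : Fin 4 → ℝ) : ℝ :=
  κ₀ + κ₁ * (y 0 ^ 2 + y 1 ^ 2) + C / 2 * (y 2 ^ 2 + y 3 ^ 2) +
    τ * (y 2 * √(Ψ (y 0 ^ 2 + y 1 ^ 2) (y 2 ^ 2 + y 3 ^ 2)))

theorem contDiffAt_edgeModel {Ψ : ℝ → ℝ → ℝ} (hΨ : ContDiff ℝ ∞ fun p : ℝ × ℝ => Ψ p.1 p.2)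
    {u : ℝ} (hu : 0 < Ψ 0 (u ^ 2)) (κ₀ κ₁ C τ : ℝ) :
    ContDiffAt ℝ ∞ (edgeModel Ψ κ₀ κ₁ C τ) ![0, 0, u, 0] := by
  have h1 : ContDiff ℝ ∞ fun y : Fin 4 → ℝ => Ψ (y 0 ^ 2 + y 1 ^ 2) (y 2 ^ 2 + y 3 ^ 2) :=
    hΨ.comp (g := fun p : ℝ × ℝ => Ψ p.1 p.2)
      (f := fun y : Fin 4 → ℝ => (y 0 ^ 2 + y 1 ^ 2, y 2 ^ 2 + y 3 ^ 2)) (by fun_prop)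
  have h2 := h1.contDiffAt (x := ![0, 0, u, 0]) |>.sqrt (by simpa using hu.ne')
  unfold edgeModel
  fun_prop

/-- The entries m and n are the second derivatives along the meridian and across it within the edge
sphere. The value of k is left free, since the linearisation of J removes it from the span. -/
theorem edgeModel_critical {Ψ : ℝ → ℝ → ℝ} (hΨ : ContDiff ℝ ∞ fun p : ℝ × ℝ => Ψ p.1 p.2)
    (hff : ∀ b, Ψ 0 b = ff b) (κ₀ κ₁ : ℝ) {C τ u : ℝ} (hu : u ^ 2 < 2) (hτ : 0 ≤ τ)
    (h0 : τ = 0 → C ≠ 0)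
    (heq : C * u * √(ff (u ^ 2)) + τ * ff (u ^ 2) + τ * u ^ 2 * deriv ff (u ^ 2) = 0) :
    fderiv ℝ (edgeModel Ψ κ₀ κ₁ C τ) ![0, 0, u, 0] = 0 ∧
    ∃ k m n, 0 < m * n ∧
      (Matrix.of fun i j => fderiv ℝ (fderiv ℝ (edgeModel Ψ κ₀ κ₁ C τ)) ![0, 0, u, 0]
        (Pi.single i 1) (Pi.single j 1)) = Matrix.diagonal ![k, k, m, n] := by
  have hf := ff_pos (sq_nonneg u) hu
  have hr := Real.sqrt_pos.2 hf
  have hr2 := Real.sq_sqrt hf.le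
  have hsm := contDiffAt_edgeModel hΨ (u := u) (by rwa [hff]) κ₀ κ₁ C τ
  have hG : ∀ y, edgeModel Ψ κ₀ κ₁ C τ y = (fun a x c => κ₀ + κ₁ * a + C / 2 * (x ^ 2 + c) +
    τ * (x * √(Ψ a (x ^ 2 + c)))) (y 0 ^ 2 + y 1 ^ 2) (y 2) (y 3 ^ 2) := fun y => rfl
  have hline : (fun s => κ₀ + κ₁ * 0 + C / 2 * ((u + s) ^ 2 + 0) +
      τ * ((u + s) * √(Ψ 0 ((u + s) ^ 2 + 0)))) = fun s => κ₀ + phi C τ (u + s) := by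
    funext s
    simp only [hff, phi]
    ring_nf
  have hd : ∀ᶠ s in 𝓝 (0 : ℝ), HasDerivAt (fun s => κ₀ + phi C τ (u + s)) (phi' C τ (u + s)) s := by
    have hc : ContinuousAt (fun s : ℝ => ff ((u + s) ^ 2)) 0 :=
      (continuous_ff.comp (by fun_prop : Continuous fun s : ℝ => (u + s) ^ 2)).continuousAt
    have := hc.eventually_const_lt (u := 0) (by simpa using hf)
    filter_upwards [this] with s hs
    exact ((hasDerivAt_phi C τ hs).comp_const_add u s).const_add κ₀
  refine ⟨fderiv_eq_zero (Φ := fun a x c => κ₀ + κ₁ * a + C / 2 * (x ^ 2 + c) +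
    τ * (x * √(Ψ a (x ^ 2 + c)))) hG (hsm.differentiableAt (by simp)) ?_, _, _, _, ?_,
    hessian_eq_diagonal (Φ := fun a x c => κ₀ + κ₁ * a + C / 2 * (x ^ 2 + c) +
    τ * (x * √(Ψ a (x ^ 2 + c)))) hG (hsm.of_le (by norm_cast)) rfl rfl rfl⟩
  · rw [hline, hd.self_of_nhds.deriv, add_zero, phi']
    field_simp
    rw [hr2]
    linear_combination heq
  · set r := √(ff (u ^ 2)) with hrdef
    have hm : deriv (deriv fun s => κ₀ + κ₁ * 0 + C / 2 * ((u + s) ^ 2 + 0) +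
        τ * ((u + s) * √(Ψ 0 ((u + s) ^ 2 + 0)))) 0 =
        C + τ * (3 * u * deriv ff (u ^ 2) / r +
      2 * u ^ 3 * (-432 + 264 * u ^ 2 + 72 * (u ^ 2) ^ 2 - 20 * (u ^ 2) ^ 3) / r -
      u ^ 3 * deriv ff (u ^ 2) ^ 2 / r ^ 3) := by
      rw [hline]
      refine deriv_deriv_eq_of_hasDerivAt hd ?_
      have := hasDerivAt_phi' C τ hf
      exact HasDerivAt.comp_const_add u 0 (by rwa [add_zero])
    have hn : deriv (deriv fun s => κ₀ + κ₁ * 0 + C / 2 * (u ^ 2 + s ^ 2) +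
        τ * (u * √(Ψ 0 (u ^ 2 + s ^ 2)))) 0 = C + τ * (u * deriv ff (u ^ 2) / r) := by
      have hlin : (fun s => κ₀ + κ₁ * 0 + C / 2 * (u ^ 2 + s ^ 2) +
          τ * (u * √(Ψ 0 (u ^ 2 + s ^ 2)))) =
          fun s => κ₀ + (C / 2 * (u ^ 2 + s ^ 2) + τ * (u * √(ff (u ^ 2 + s ^ 2)))) := by
        funext s
        rw [hff]
        ring
      have hg : ∀ s : ℝ, HasDerivAt (fun s => u ^ 2 + s ^ 2) (2 * s) s := fun s => by
        simpa using (hasDerivAt_pow 2 s).const_add (u ^ 2)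
      have hpos : ∀ᶠ s : ℝ in 𝓝 0, 0 < ff (u ^ 2 + s ^ 2) := by
        have hc : ContinuousAt (fun s : ℝ => ff (u ^ 2 + s ^ 2)) 0 :=
          (continuous_ff.comp (by fun_prop : Continuous fun s : ℝ => u ^ 2 + s ^ 2)).continuousAt
        exact hc.eventually_const_lt (u := 0) (by simpa using hf)
      have hD : ∀ s : ℝ, 0 < ff (u ^ 2 + s ^ 2) → HasDerivAt (fun s => √(ff (u ^ 2 + s ^ 2)))
          (deriv ff (u ^ 2 + s ^ 2) * (2 * s) / (2 * √(ff (u ^ 2 + s ^ 2)))) s := fun s hs =>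
        (HasDerivAt.comp (h₂ := ff) (h := fun s : ℝ => u ^ 2 + s ^ 2) s
          (hasDerivAt_ff _).differentiableAt.hasDerivAt (hg s)).sqrt hs.ne'
      rw [hlin]
      -- The factor s is kept outside the quotient: at s = 0 the product rule then needs only
      -- differentiability of the quotient, not its derivative.
      refine deriv_deriv_eq_of_hasDerivAt (g' := fun s => C * s + τ * (u *
        (s * (deriv ff (u ^ 2 + s ^ 2) / √(ff (u ^ 2 + s ^ 2)))))) ?_ ?_
      · filter_upwards [hpos] with s hs
        refine ((((hg s).const_mul (C / 2)).add (((hD s hs).const_mul u).const_mul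
          τ)).const_add κ₀).congr_deriv ?_
        have := (Real.sqrt_pos.2 hs).ne'
        field_simp
      · have hq : DifferentiableAt ℝ (fun s => deriv ff (u ^ 2 + s ^ 2) / √(ff (u ^ 2 + s ^ 2)))
            0 := by
          refine DifferentiableAt.div (DifferentiableAt.comp (g := deriv ff)
            (f := fun s : ℝ => u ^ 2 + s ^ 2) 0 (hasDerivAt_deriv_ff _).differentiableAt
            (hg 0).differentiableAt) (hD 0 (by simpa using hf)).differentiableAt ?_
          simpa using hr.ne'
        refine (((hasDerivAt_id (0 : ℝ)).const_mul C).add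
          ((((hasDerivAt_id (0 : ℝ)).mul hq.hasDerivAt).const_mul u).const_mul τ)).congr_deriv ?_
        simp [hrdef, mul_div_assoc]
    rw [hm, hn]
    rcases hτ.eq_or_lt with h | hτ
    · have := h0 h.symm
      rw [← h]
      simpa using mul_self_pos.2 this
    -- At u = 0 the critical equation would read τ 𝔣(0) = 0.
    · have hu0 : u ≠ 0 := by
        rintro rfl
        simp at heq hf
        rcases heq with h | h
        · exact hτ.ne' h
        · exact hf.ne' h
      have hcon := concavity_inequality (sq_nonneg u) hu
      set f₁ := deriv ff (u ^ 2)
      set f₂ := -432 + 264 * u ^ 2 + 72 * (u ^ 2) ^ 2 - 20 * (u ^ 2) ^ 3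
      rw [← hr2] at hcon heq
      set A := C + τ * (3 * u * f₁ / r + 2 * u ^ 3 * f₂ / r - u ^ 3 * f₁ ^ 2 / r ^ 3) with hA
      set B := C + τ * (u * f₁ / r) with hB
      -- The critical equation eliminates C from A and B. Both resulting expressions are negative,
      -- the first by the concavity inequality, so A B > 0 whatever the sign of u.
      have e1 : u * r ^ 3 * A = τ * (2 * u ^ 2 * r ^ 2 * (2 * f₁ + u ^ 2 * f₂) -
          (r ^ 2 + u ^ 2 * f₁) ^ 2) := by
        rw [hA]
        field_simp
        linear_combination r ^ 2 * heq
      have e2 : u * r * B = -(τ * r ^ 2) := by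
        rw [hB]
        field_simp
        linear_combination heq
      have n1 : u * r ^ 3 * A < 0 := by
        rw [e1]; exact mul_neg_of_pos_of_neg hτ (by linarith)
      have n2 : u * r * B < 0 := by
        rw [e2]; exact neg_neg_of_pos (by positivity)
      have n3 := mul_pos_of_neg_of_neg n1 n2
      have e3 : u * r ^ 3 * A * (u * r * B) = u ^ 2 * r ^ 4 * (A * B) := by ring
      rw [e3] at n3
      exact (mul_pos_iff_of_pos_left (by positivity)).1 n3

/-! ### Existence of the branches -/

/-- With `w = ζ - 1`, `ζ 𝔣(ζ) = (1 - w²) quad (w²)`. -/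
def quad (W : ℝ) : ℝ := (9 - W) * (49 - W)

/-- With `w = ζ - 1`, the derivative of `ζ 𝔣(ζ)` is `-w slope (w²)`. -/
def slope (W : ℝ) : ℝ := 2 * (499 - 118 * W + 3 * W ^ 2)

theorem quad_pos {W : ℝ} (h : W ≤ 1) : 0 < quad W :=
  mul_pos (by linarith) (by linarith)

theorem slope_pos {W : ℝ} (h : W ≤ 1) : 0 < slope W := by
  unfold slope
  nlinarith [sq_nonneg W]

/-- The quotient `slope / √quad`. -/
def ratio (W : ℝ) : ℝ := slope W / √(quad W)

theorem ratio_pos {W : ℝ} (h : W ≤ 1) : 0 < ratio W :=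
  div_pos (slope_pos h) (Real.sqrt_pos.2 (quad_pos h))

theorem contDiffAt_ratio {W : ℝ} (h : W ≤ 1) : ContDiffAt ℝ ∞ ratio W := by
  have hq : ContDiffAt ℝ ∞ quad W := by unfold quad; fun_prop
  have hs : ContDiffAt ℝ ∞ slope W := by unfold slope; fun_prop
  exact hs.div (hq.sqrt (quad_pos h).ne') (Real.sqrt_pos.2 (quad_pos h)).ne'

/-- For W = sin² α, γ times this expression is the cross product of (cos α, `height γ α`) with its
derivative; its sign makes the polar angle increase. -/
theorem ratio_add_deriv_pos {W : ℝ} (h0 : 0 ≤ W) (h1 : W ≤ 1) :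
    0 < ratio W + 2 * W * (1 - W) * deriv ratio W := by
  have hq := quad_pos h1
  have hr := Real.sqrt_pos.2 hq
  have hdq : HasDerivAt quad (-(58 - 2 * W)) W := by
    refine (((hasDerivAt_id W).const_sub 9).mul ((hasDerivAt_id W).const_sub 49)).congr_deriv ?_
    simp; ring
  have hds : HasDerivAt slope (2 * (-118 + 6 * W)) W := by
    refine ((((hasDerivAt_id W).const_mul 118).const_sub 499).add
      ((hasDerivAt_pow 2 W).const_mul 3) |>.const_mul 2).congr_deriv ?_
    simp; ring
  have hd : HasDerivAt ratio _ W := hds.div (hdq.sqrt hq.ne') hr.ne'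
  have hs := slope_pos h1
  rw [hd.deriv]
  have e : ratio W + 2 * W * (1 - W) * ((2 * (-118 + 6 * W) * √(quad W) -
      slope W * (-(58 - 2 * W) / (2 * √(quad W)))) / √(quad W) ^ 2) =
      (slope W + 2 * W * (1 - W) * (2 * (-118 + 6 * W))) / √(quad W) +
        W * (1 - W) * slope W * (58 - 2 * W) / √(quad W) ^ 3 := by
    rw [ratio]
    field_simp
    ring
  rw [e]
  have h2 : 0 < slope W + 2 * W * (1 - W) * (2 * (-118 + 6 * W)) := by
    unfold slope
    have : 2 * (499 - 118 * W + 3 * W ^ 2) + 2 * W * (1 - W) * (2 * (-118 + 6 * W)) =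
      998 - 708 * W + 502 * W ^ 2 - 24 * W ^ 3 := by ring
    rw [this]
    nlinarith [mul_nonneg h0 (sub_nonneg.2 h1), mul_nonneg (sq_nonneg W) (sub_nonneg.2 h1)]
  have h3 : 0 ≤ W * (1 - W) * slope W * (58 - 2 * W) := by
    have : 0 ≤ 1 - W := by linarith
    have : 0 ≤ 58 - 2 * W := by linarith
    positivity
  positivity

theorem sin_sq_le (α : ℝ) : Real.sin α ^ 2 ≤ 1 := Real.sin_sq_le_one α

/-- The height `γ sin α ratio (sin² α)`. -/
def height (γ α : ℝ) : ℝ := γ * (Real.sin α * ratio (Real.sin α ^ 2))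

theorem contDiff_height (γ : ℝ) : ContDiff ℝ ∞ (height γ) := by
  rw [contDiff_iff_contDiffAt]
  intro α
  have h := (contDiffAt_ratio (sin_sq_le α)).comp (f := fun α => Real.sin α ^ 2) α
    (by fun_prop)
  have h' : ContDiffAt ℝ ∞ (fun α => ratio (Real.sin α ^ 2)) α := h
  unfold height
  fun_prop

theorem sin_mul_height_nonneg {γ : ℝ} (hγ : 0 < γ) (α : ℝ) :
    0 ≤ Real.sin α * height γ α := by
  have := ratio_pos (sin_sq_le α)
  have e : Real.sin α * height γ α = γ * Real.sin α ^ 2 * ratio (Real.sin α ^ 2) := by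
    unfold height; ring
  rw [e]
  positivity

/-- This is the inner product of (cos α, `height γ α`) with (cos α, sin α). Positivity keeps the
angle between them in (-π/2, π/2), where one arctangent describes it smoothly. -/
theorem denom_pos {γ : ℝ} (hγ : 0 < γ) (α : ℝ) :
    0 < Real.cos α ^ 2 + Real.sin α * height γ α := by
  have h := sin_mul_height_nonneg hγ α
  rcases eq_or_ne (Real.cos α) 0 with hc | hc
  · have h1 : Real.sin α ^ 2 = 1 := by
      have := Real.sin_sq_add_cos_sq α
      rw [hc] at this
      linarith
    have e : Real.sin α * height γ α = γ * Real.sin α ^ 2 * ratio (Real.sin α ^ 2) := by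
      unfold height; ring
    rw [e, h1, hc]
    have := ratio_pos (le_refl 1)
    positivity
  · positivity

/-- The polar angle of the vector `(cos α, height γ α)`. -/
def polar (γ α : ℝ) : ℝ :=
  -- The angle α of (cos α, sin α) is corrected by the angle from that unit vector to (cos α,
  -- height), whose tangent is cross product over inner product. This gives a global smooth lift.
  α + Real.arctan ((Real.cos α * height γ α - Real.sin α * Real.cos α) /
    (Real.cos α ^ 2 + Real.sin α * height γ α))

theorem contDiff_polar {γ : ℝ} (hγ : 0 < γ) : ContDiff ℝ ∞ (polar γ) := by
  have h := contDiff_height γ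
  unfold polar
  refine contDiff_id.add (Real.contDiff_arctan.comp (ContDiff.div ?_ ?_ ?_))
  · fun_prop
  · fun_prop
  · exact fun α => (denom_pos hγ α).ne'

theorem exists_polar_eq {γ : ℝ} (hγ : 0 < γ) (α : ℝ) :
    ∃ l : ℝ, l * Real.cos (polar γ α) = Real.cos α ∧ l * Real.sin (polar γ α) = height γ α := by
  have hD := denom_pos hγ α
  have hsc := Real.sin_sq_add_cos_sq α
  -- The witness is the length of the vector, √(D² + N²) written as D √(1 + (N/D)²).
  refine ⟨(Real.cos α ^ 2 + Real.sin α * height γ α) *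
    √(1 + ((Real.cos α * height γ α - Real.sin α * Real.cos α) /
      (Real.cos α ^ 2 + Real.sin α * height γ α)) ^ 2), ?_, ?_⟩
  · rw [polar, Real.cos_add, Real.cos_arctan, Real.sin_arctan]
    set x := (Real.cos α * height γ α - Real.sin α * Real.cos α) /
      (Real.cos α ^ 2 + Real.sin α * height γ α) with hx
    have hs : 0 < √(1 + x ^ 2) := Real.sqrt_pos.2 (by positivity)
    have hxD : (Real.cos α ^ 2 + Real.sin α * height γ α) * x =
      Real.cos α * height γ α - Real.sin α * Real.cos α := by
      rw [hx]; field_simp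
    field_simp
    linear_combination -Real.sin α * hxD + Real.cos α * hsc
  · rw [polar, Real.sin_add, Real.cos_arctan, Real.sin_arctan]
    set x := (Real.cos α * height γ α - Real.sin α * Real.cos α) /
      (Real.cos α ^ 2 + Real.sin α * height γ α) with hx
    have hs : 0 < √(1 + x ^ 2) := Real.sqrt_pos.2 (by positivity)
    have hxD : (Real.cos α ^ 2 + Real.sin α * height γ α) * x =
      Real.cos α * height γ α - Real.sin α * Real.cos α := by
      rw [hx]; field_simp
    field_simp
    linear_combination Real.cos α * hxD + height γ α * hsc

/-- The derivative of a polar angle is the cross product of the vector with its derivative, divided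
by the squared length; `ratio_add_deriv_pos` gives the sign. -/
theorem deriv_polar_pos {γ : ℝ} (hγ : 0 < γ) (α : ℝ) : 0 < deriv (polar γ) α := by
  have hD := denom_pos hγ α
  have hsc := Real.sin_sq_add_cos_sq α
  have hR : HasDerivAt ratio (deriv ratio (Real.sin α ^ 2)) (Real.sin α ^ 2) :=
    ((contDiffAt_ratio (sin_sq_le α)).differentiableAt (by simp)).hasDerivAt
  have hc := Real.hasDerivAt_cos α
  have hs := Real.hasDerivAt_sin α
  have hh : HasDerivAt (height γ) (γ * (Real.cos α * ratio (Real.sin α ^ 2) + Real.sin α *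
      (deriv ratio (Real.sin α ^ 2) * (2 * Real.sin α * Real.cos α)))) α := by
    refine ((hs.mul (HasDerivAt.comp (h₂ := ratio) (h := fun α => Real.sin α ^ 2) α hR
      (hs.pow 2))).const_mul γ).congr_deriv ?_
    simp
  set h' := γ * (Real.cos α * ratio (Real.sin α ^ 2) + Real.sin α *
      (deriv ratio (Real.sin α ^ 2) * (2 * Real.sin α * Real.cos α))) with hh'
  have hpos : 0 < Real.cos α * h' + Real.sin α * height γ α := by
    have e : Real.cos α * h' + Real.sin α * height γ α = γ * (ratio (Real.sin α ^ 2) +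
        2 * Real.sin α ^ 2 * (1 - Real.sin α ^ 2) * deriv ratio (Real.sin α ^ 2)) := by
      rw [hh', height]
      have : Real.cos α ^ 2 = 1 - Real.sin α ^ 2 := by linarith
      linear_combination γ * (ratio (Real.sin α ^ 2) + 2 * Real.sin α ^ 2 *
        deriv ratio (Real.sin α ^ 2)) * this
    rw [e]
    exact mul_pos hγ (ratio_add_deriv_pos (sq_nonneg _) (sin_sq_le α))
  have hp : HasDerivAt (polar γ) _ α := (hasDerivAt_id α).add ((((hc.mul hh).sub
    (hs.mul hc)).div ((hc.pow 2).add (hs.mul hh)) hD.ne').arctan)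
  rw [hp.deriv]
  have key : ∀ N D N' D' : ℝ, 0 < D → N' = Real.cos α * h' - Real.sin α * -Real.sin α
      - Real.sin α * height γ α - Real.cos α * Real.cos α →
      D' = 2 * Real.cos α * -Real.sin α + Real.cos α * height γ α + Real.sin α * h' →
      N = Real.cos α * height γ α - Real.sin α * Real.cos α →
      D = Real.cos α ^ 2 + Real.sin α * height γ α →
      0 < 1 + 1 / (1 + (N / D) ^ 2) * ((N' * D - N * D') / D ^ 2) := by
    intro N D N' D' hD hN' hD' hN hDe
    have e : 1 + 1 / (1 + (N / D) ^ 2) * ((N' * D - N * D') / D ^ 2) =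
        (D ^ 2 + N ^ 2 + (N' * D - N * D')) / (D ^ 2 + N ^ 2) := by
      have : D ^ 2 + N ^ 2 ≠ 0 := by positivity
      field_simp
    have e2 : D ^ 2 + N ^ 2 + (N' * D - N * D') = Real.cos α * h' + Real.sin α * height γ α := by
      rw [hN', hD', hN, hDe]
      have hc2 : Real.cos α ^ 2 = 1 - Real.sin α ^ 2 := by linarith
      generalize Real.cos α = c at *
      generalize Real.sin α = s at *
      generalize height γ α = v at *
      have h3 : c ^ 3 = c * (1 - s ^ 2) := by rw [← hc2]; ring
      ring_nf
      simp only [h3, hc2]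
      ring
    rw [e, e2]
    positivity
  refine key _ _ _ _ hD ?_ ?_ rfl rfl
  · simp; ring
  · simp; ring

/-- `polar γ` differs from the identity by less than π/2. -/
theorem polar_surjective {γ : ℝ} (hγ : 0 < γ) : Function.Surjective (polar γ) := by
  refine (contDiff_polar hγ).continuous.surjective ?_ ?_
  · refine tendsto_atTop_mono (f := fun α => α + -(Real.pi / 2)) (fun α => ?_)
      (tendsto_atTop_add_const_right _ _ tendsto_id)
    exact add_le_add_right (Real.neg_pi_div_two_lt_arctan _).le α
  · refine tendsto_atBot_mono (f := fun α => α + Real.pi / 2) (fun α => ?_)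
      (tendsto_atBot_add_const_right _ _ tendsto_id)
    exact add_le_add_right (Real.arctan_lt_pi_div_two _).le α

theorem polar_strictMono {γ : ℝ} (hγ : 0 < γ) : StrictMono (polar γ) :=
  strictMono_of_deriv_pos (deriv_polar_pos hγ)

/-- `polar` as a homeomorphism of the line. -/
def polarHomeo {γ : ℝ} (hγ : 0 < γ) : ℝ ≃ₜ ℝ :=
  ((polar_strictMono hγ).orderIsoOfSurjective (polar γ) (polar_surjective hγ)).toHomeomorph

theorem polarHomeo_apply {γ : ℝ} (hγ : 0 < γ) (α : ℝ) : polarHomeo hγ α = polar γ α := rfl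

theorem contDiff_polarHomeo_symm {γ : ℝ} (hγ : 0 < γ) : ContDiff ℝ ∞ (polarHomeo hγ).symm :=
  (polarHomeo hγ).contDiff_symm_deriv (f' := deriv (polar γ))
    (fun α => (deriv_polar_pos hγ α).ne')
    (fun α => ((contDiff_polar hγ).differentiable (by simp) α).hasDerivAt) (contDiff_polar hγ)

/-- The polar angle of the vector `(t, 1 - 2t)`. -/
def targetAngle (t : ℝ) : ℝ := Real.arctan (2⁻¹) + Real.arctan (2 - 5 * t)

theorem targetAngle_zero : targetAngle 0 = Real.pi / 2 := by
  rw [targetAngle, Real.arctan_inv_of_pos (by norm_num)]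
  simp

theorem targetAngle_le {t : ℝ} (ht : 0 ≤ t) : targetAngle t ≤ Real.pi / 2 := by
  rw [← targetAngle_zero]
  exact add_le_add_right (Real.arctan_strictMono.monotone (by linarith)) _

theorem neg_pi_div_two_le_targetAngle (t : ℝ) : -(Real.pi / 2) ≤ targetAngle t := by
  have h1 : 0 < Real.arctan (2⁻¹) := Real.arctan_pos.2 (by norm_num)
  have h2 := Real.neg_pi_div_two_lt_arctan (2 - 5 * t)
  unfold targetAngle
  linarith

/-- The sum of arctangents reflects (2 + i)(1 + (2 - 5t) i) = 5 (t + (1 - 2t) i); unlike the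
arctangent of (1 - 2t)/t, it is smooth at t = 0. -/
theorem targetAngle_eq (t : ℝ) :
    (1 - 2 * t) * Real.cos (targetAngle t) = t * Real.sin (targetAngle t) := by
  rw [targetAngle, Real.cos_add, Real.sin_add, Real.cos_arctan, Real.sin_arctan, Real.cos_arctan,
    Real.sin_arctan]
  have h1 : 0 < √(1 + (2⁻¹ : ℝ) ^ 2) := Real.sqrt_pos.2 (by positivity)
  have h2 : 0 < √(1 + (2 - 5 * t) ^ 2) := Real.sqrt_pos.2 (by positivity)
  field_simp
  ring

theorem polar_pi_div_two (γ : ℝ) : polar γ (Real.pi / 2) = Real.pi / 2 := by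
  simp [polar]

theorem polar_neg_pi_div_two (γ : ℝ) : polar γ (-(Real.pi / 2)) = -(Real.pi / 2) := by
  simp [polar]

/-- The angle is the inverse of `polar` applied to `targetAngle`. Since `polar` fixes ±π/2, bounds
on the target pass to α; they give cos α ≥ 0, which fixes the sign of the square root later. -/
theorem exists_angle {γ : ℝ} (hγ : 0 < γ) : ∃ α : ℝ → ℝ, ContDiff ℝ ∞ α ∧ α 0 = Real.pi / 2 ∧
    ∀ t, 0 ≤ t → -(Real.pi / 2) ≤ α t ∧ α t ≤ Real.pi / 2 ∧
      (1 - 2 * t) * Real.cos (α t) =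
        t * (γ * (Real.sin (α t) * ratio (Real.sin (α t) ^ 2))) := by
  have hp : ∀ t, polar γ ((polarHomeo hγ).symm (targetAngle t)) = targetAngle t := fun t => by
    rw [← polarHomeo_apply hγ, Homeomorph.apply_symm_apply]
  refine ⟨fun t => (polarHomeo hγ).symm (targetAngle t), ?_, ?_, fun t ht => ⟨?_, ?_, ?_⟩⟩
  · have : ContDiff ℝ ∞ targetAngle := by
      unfold targetAngle
      exact contDiff_const.add (Real.contDiff_arctan.comp (by fun_prop))
    exact (contDiff_polarHomeo_symm hγ).comp this
  · apply (polar_strictMono hγ).injective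
    rw [hp, targetAngle_zero, polar_pi_div_two]
  · rw [← (polar_strictMono hγ).le_iff_le, hp, polar_neg_pi_div_two]
    exact neg_pi_div_two_le_targetAngle t
  · rw [← (polar_strictMono hγ).le_iff_le, hp, polar_pi_div_two]
    exact targetAngle_le ht
  · obtain ⟨l, h1, h2⟩ := exists_polar_eq hγ ((polarHomeo hγ).symm (targetAngle t))
    rw [hp] at h1 h2
    change _ = t * height γ _
    rw [← h1, ← h2]
    linear_combination l * targetAngle_eq t

theorem mul_sqrt_ff {u w c : ℝ} (hu : 0 ≤ u) (hc : 0 ≤ c) (hw : u ^ 2 = 1 + w)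
    (hwc : w ^ 2 + c ^ 2 = 1) : u * √(ff (u ^ 2)) = c * √(quad (w ^ 2)) := by
  have e : u ^ 2 * ff (u ^ 2) = c ^ 2 * quad (w ^ 2) := by
    rw [hw, ff, quad, eq_sub_of_add_eq' hwc]
    ring
  rw [← Real.sqrt_sq hu, ← Real.sqrt_mul (sq_nonneg _), Real.sqrt_sq hu, e,
    Real.sqrt_mul (sq_nonneg _), Real.sqrt_sq hc]

theorem ff_add_mul_deriv (w : ℝ) :
    ff (1 + w) + (1 + w) * deriv ff (1 + w) = -(w * slope (w ^ 2)) := by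
  rw [deriv_ff, ff, slope]
  ring

theorem abs_sqrt_two_mul_le {x : ℝ} (h : |x| ≤ 1) : √2 * x ∈ Set.Icc (-√2) √2 := by
  have h2 := Real.sqrt_nonneg 2
  obtain ⟨h3, h4⟩ := abs_le.1 h
  constructor <;> nlinarith

/-- The reflection of `[-√2, √2]`. -/
def negIcc (u : Set.Icc (-√2) √2) : Set.Icc (-√2) √2 :=
  ⟨-u, neg_le_neg u.2.2, neg_le.1 u.2.1⟩

theorem IsBranch.neg {γ u₀ : ℝ} {u : ℝ → Set.Icc (-√2) √2} (h : IsBranch γ 1 u₀ u) :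
    IsBranch γ (-1) (-u₀) (fun t => negIcc (u t)) where
  smooth := h.smooth.neg
  initial := by simp [negIcc, h.initial]
  equation t ht := by
    have := h.equation t ht
    simp only [negIcc, neg_sq]
    linear_combination this

theorem exists_branches {γ : ℝ} (hγ : 0 < γ) : ∃ uMin uMax : ℝ → Set.Icc (-√2) √2,
    IsBranch γ 1 0 uMin ∧ IsBranch γ 1 (√2) uMax := by
  obtain ⟨α, hα, hα0, h⟩ := exists_angle hγ
  have hdouble : ∀ t, 2 * (α t / 2 + Real.pi / 4) = α t + Real.pi / 2 := fun t => by ring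
  have h22 : (√2 : ℝ) ^ 2 = 2 := Real.sq_sqrt (by norm_num)
  have hsin : ∀ t, (√2 * Real.sin (α t / 2 + Real.pi / 4)) ^ 2 = 1 + Real.sin (α t) := by
    intro t
    have := Real.cos_two_mul (α t / 2 + Real.pi / 4)
    rw [hdouble, Real.cos_add_pi_div_two, Real.cos_sq'] at this
    rw [mul_pow, h22]
    linarith
  have hcos : ∀ t, (√2 * Real.cos (α t / 2 + Real.pi / 4)) ^ 2 = 1 + -Real.sin (α t) := by
    intro t
    have := Real.cos_two_mul (α t / 2 + Real.pi / 4)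
    rw [hdouble, Real.cos_add_pi_div_two] at this
    rw [mul_pow, h22]
    linarith
  have hratio : ∀ t, ratio (Real.sin (α t) ^ 2) * √(quad (Real.sin (α t) ^ 2)) =
      slope (Real.sin (α t) ^ 2) := fun t =>
    div_mul_cancel₀ _ (Real.sqrt_pos.2 (quad_pos (sin_sq_le _))).ne'
  -- By the half-angle formulas these are smooth square roots: u₊² = 1 + sin α and u₋² = 1 - sin α.
  -- Changing the signs of both u and w only negates the equation, so the same α serves both
  -- branches.
  refine ⟨fun t => negIcc ⟨_, abs_sqrt_two_mul_le
      (Real.abs_cos_le_one (α t / 2 + Real.pi / 4))⟩,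
    fun t => ⟨_, abs_sqrt_two_mul_le (Real.abs_sin_le_one (α t / 2 + Real.pi / 4))⟩,
    ⟨?_, ?_, fun t ht => ?_⟩, ⟨?_, ?_, fun t ht => ?_⟩⟩
  · simp only [negIcc]
    fun_prop
  · simp only [negIcc, hα0]
    rw [show Real.pi / 2 / 2 + Real.pi / 4 = Real.pi / 2 by ring]
    simp
  · obtain ⟨h1, h2, h3⟩ := h t ht.1
    have hnn : 0 ≤ √2 * Real.cos (α t / 2 + Real.pi / 4) :=
      mul_nonneg (Real.sqrt_nonneg _) (Real.cos_nonneg_of_mem_Icc ⟨by linarith, by linarith⟩)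
    have e1 := mul_sqrt_ff hnn (Real.cos_nonneg_of_mem_Icc ⟨h1, h2⟩) (hcos t)
      (by rw [neg_sq]; exact Real.sin_sq_add_cos_sq _)
    have e2 := ff_add_mul_deriv (-Real.sin (α t))
    simp only [negIcc, neg_sq]
    rw [hcos] at e1 ⊢
    rw [neg_sq] at e1 e2
    linear_combination (-(1 - 2 * t)) * e1 + γ * t * e2 - √(quad (Real.sin (α t) ^ 2)) * h3 -
      γ * t * Real.sin (α t) * hratio t
  · fun_prop
  · simp only [hα0]
    rw [show Real.pi / 2 / 2 + Real.pi / 4 = Real.pi / 2 by ring]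
    simp
  · obtain ⟨h1, h2, h3⟩ := h t ht.1
    have hnn : 0 ≤ √2 * Real.sin (α t / 2 + Real.pi / 4) :=
      mul_nonneg (Real.sqrt_nonneg _)
        (Real.sin_nonneg_of_nonneg_of_le_pi (by linarith) (by linarith [Real.pi_pos]))
    have e1 := mul_sqrt_ff hnn (Real.cos_nonneg_of_mem_Icc ⟨h1, h2⟩) (hsin t)
      (Real.sin_sq_add_cos_sq _)
    have e2 := ff_add_mul_deriv (Real.sin (α t))
    rw [hsin] at e1 ⊢
    linear_combination (1 - 2 * t) * e1 + γ * t * e2 + √(quad (Real.sin (α t) ^ 2)) * h3 +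
      γ * t * Real.sin (α t) * hratio t

/-! ### Nondegeneracy of the fixed points -/

theorem localRep_eventuallyEq {f : M → ℝ} {F : (Fin 4 → ℝ) → ℝ} {ν : Fin 8}
    (h : ∀ y : V ν, f (param ν y) = F y) (x : V ν) : localRep f ν =ᶠ[𝓝 x.1] F := by
  filter_upwards [(isOpen_V ν).mem_nhds x.2] with y hy
  rw [localRep_of_mem hy, h]

theorem hessian_eq {f : M → ℝ} {F : (Fin 4 → ℝ) → ℝ} {ν : Fin 8}
    (h : ∀ y : V ν, f (param ν y) = F y) (x : V ν) :
    hessian f ν x = Matrix.of fun i j =>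
      fderiv ℝ (fderiv ℝ F) x (Pi.single i 1) (Pi.single j 1) := by
  rw [hessian, (localRep_eventuallyEq h x).fderiv.fderiv_eq]

theorem linearization_eq {f : M → ℝ} {F : (Fin 4 → ℝ) → ℝ} {ν : Fin 8}
    (h : ∀ y : V ν, f (param ν y) = F y) (x : V ν) {p q m n : ℝ}
    (hF : (Matrix.of fun i j => fderiv ℝ (fderiv ℝ F) x (Pi.single i 1) (Pi.single j 1)) =
      Matrix.diagonal ![p, q, m, n]) :
    linearization f ν x = blockMat p q m n := by
  rw [linearization, hessian_eq h, hF, omega_eq x.2]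
  exact Omega0_inv_mul_diagonal p q m n

theorem isFixedAt_of_models {f g : M → ℝ} {F G : (Fin 4 → ℝ) → ℝ} {ν : Fin 8}
    (hf : ∀ y : V ν, f (param ν y) = F y) (hg : ∀ y : V ν, g (param ν y) = G y) (x : V ν)
    (hF : ContDiffAt ℝ ∞ F x) (hG : ContDiffAt ℝ ∞ G x) (hF' : fderiv ℝ F x = 0)
    (hG' : fderiv ℝ G x = 0) : IsFixedAt f g ν x :=
  have ef := localRep_eventuallyEq hf x
  have eg := localRep_eventuallyEq hg x
  ⟨hF.congr_of_eventuallyEq ef, hG.congr_of_eventuallyEq eg, ef.fderiv_eq.trans hF',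
    eg.fderiv_eq.trans hG'⟩

theorem mem_linSpan {f g : M → ℝ} {ν : Fin 8} {x : Fin 4 → ℝ} {p q m n p' q' m' n' : ℝ}
    (hf : linearization f ν x = blockMat p q m n)
    (hg : linearization g ν x = blockMat p' q' m' n') (A : Matrix (Fin 4) (Fin 4) ℝ) :
    A ∈ linSpan f g ν x ↔ ∃ a b : ℝ, A =
      blockMat (a * p + b * p') (a * q + b * q') (a * m + b * m') (a * n + b * n') := by
  rw [linSpan, hf, hg, Submodule.mem_span_pair]
  simp only [smul_blockMat_add, eq_comm (b := A)]

/-- Points in the interior of an edge. -/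
theorem isEllipticElliptic_edge {f g : M → ℝ} {ν : Fin 8} {Ψ : ℝ → ℝ → ℝ}
    {κ j κ₀ κ₁ C τ u : ℝ} (hx : ![0, 0, u, 0] ∈ V ν)
    (hf : ∀ y : V ν, f (param ν y) = affineModel κ j 0 y)
    (hg : ∀ y : V ν, g (param ν y) = edgeModel Ψ κ₀ κ₁ C τ y) (hj : j ≠ 0)
    (hΨ : ContDiff ℝ ∞ fun p : ℝ × ℝ => Ψ p.1 p.2)
    (hff : ∀ b, Ψ 0 b = ff b) (hu : u ^ 2 < 2) (hτ : 0 ≤ τ) (h0 : τ = 0 → C ≠ 0)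
    (heq : C * u * √(ff (u ^ 2)) + τ * ff (u ^ 2) + τ * u ^ 2 * deriv ff (u ^ 2) = 0) :
    IsEllipticElliptic f g (param ν ⟨_, hx⟩) := by
  obtain ⟨hd, k, m, n, hmn, hh⟩ := edgeModel_critical hΨ hff κ₀ κ₁ hu hτ h0 heq
  refine isEllipticElliptic_of_linSpan (p := 1) (q := 1) _ (by norm_num) hmn (omega_eq hx)
    (isFixedAt_of_models hf hg _ (contDiff_affineModel _ _ _).contDiffAt
      (contDiffAt_edgeModel hΨ (by rw [hff]; exact ff_pos (sq_nonneg u) hu) _ _ _ _)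
      (fderiv_affineModel (zero_mul u)) hd) fun A => ?_
  rw [mem_linSpan (linearization_eq hf ⟨_, hx⟩ (hessian_affineModel _ _ _ _))
    (linearization_eq hg ⟨_, hx⟩ hh)]
  constructor
  · rintro ⟨a, b, rfl⟩
    exact ⟨a * (2 * j) + b * k, b, by ring_nf⟩
  · rintro ⟨s, t, rfl⟩
    -- The linearisation of J lives in the first block alone, so its coefficient cancels k and
    -- leaves any prescribed s.
    refine ⟨(s - t * k) / (2 * j), t, ?_⟩
    have : (s - t * k) / (2 * j) * (2 * j) = s - t * k := div_mul_cancel₀ _ (by simpa using hj)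
    rw [this]
    ring_nf

/-- Points over a vertex. -/
theorem isEllipticElliptic_vertex {f g : M → ℝ} {ν : Fin 8} {κ j κ₀ κ₁ κ₂ : ℝ}
    (hx : ![0, 0, 0, 0] ∈ V ν)
    (hf : ∀ y : V ν, f (param ν y) = affineModel κ 0 j y)
    (hg : ∀ y : V ν, g (param ν y) = affineModel κ₀ κ₁ κ₂ y) (hj : j ≠ 0) (h1 : κ₁ ≠ 0) :
    IsEllipticElliptic f g (param ν ⟨_, hx⟩) := by
  refine isEllipticElliptic_of_linSpan (p := 1) (q := 1) (m := 1) (n := 1) _ (by norm_num)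
    (by norm_num) (omega_eq hx)
    (isFixedAt_of_models hf hg _ (contDiff_affineModel _ _ _).contDiffAt
      (contDiff_affineModel _ _ _).contDiffAt
      (fderiv_affineModel (mul_zero _)) (fderiv_affineModel (mul_zero _))) fun A => ?_
  rw [mem_linSpan (linearization_eq hf ⟨_, hx⟩ (hessian_affineModel _ _ _ _))
    (linearization_eq hg ⟨_, hx⟩ (hessian_affineModel _ _ _ _))]
  constructor
  · rintro ⟨a, b, rfl⟩
    exact ⟨b * (2 * κ₁), a * (2 * j) + b * (2 * κ₂), by ring_nf⟩
  · rintro ⟨s, t, rfl⟩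
    refine ⟨(t - s / (2 * κ₁) * (2 * κ₂)) / (2 * j), s / (2 * κ₁), ?_⟩
    congr 1 <;> field_simp <;> ring

theorem isEllipticElliptic_pPoint {γ t : ℝ} (hγ : 0 < γ) (ht : 0 ≤ t)
    (u : Set.Icc (-√2) √2) (hu : (u : ℝ) ^ 2 < 2)
    (heq : 1 * (1 - 2 * t) * (u : ℝ) * √(ff ((u : ℝ) ^ 2)) + γ * t * ff ((u : ℝ) ^ 2) +
      γ * t * (u : ℝ) ^ 2 * deriv ff ((u : ℝ) ^ 2) = 0) :
    IsEllipticElliptic J (Ht γ t) (pPoint u) := by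
  rw [← param_zero u hu]
  -- The constants come from |z₃|² = 2 - |z₁|² + |z₂|².
  refine isEllipticElliptic_edge (κ := 0) (j := 1 / 2) (κ₀ := 1 - 2 * t)
    (κ₁ := -(1 - 2 * t) / 2) (C := 1 - 2 * t) (τ := γ * t) (Ψ := fun a b =>
      sqMod 0 a b 2 * sqMod 0 a b 3 * sqMod 0 a b 5 * sqMod 0 a b 6 * sqMod 0 a b 7)
    (mem_V_zero hu) (fun y => ?_) (fun y => ?_) (by norm_num) ?_ (fun b => ?_) hu
    (by positivity) (fun h => ?_) (by linear_combination heq)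
  · rw [J_param]
    simp [affineModel, sqAt, sqMod, det2, normal, offset]
    ring
  · rw [Ht, H_param, X_param_zero]
    simp only [edgeModel, sqAt]
    have : sqMod 0 (y.1 0 ^ 2 + y.1 1 ^ 2) (y.1 2 ^ 2 + y.1 3 ^ 2) 2 =
        2 - (y.1 0 ^ 2 + y.1 1 ^ 2) + (y.1 2 ^ 2 + y.1 3 ^ 2) := by
      simp [sqMod, det2, normal, offset]; ring
    rw [this]
    ring
  · unfold sqMod
    fun_prop
  · simp [sqMod, det2, normal, offset, ff]
    ring
  · have : t = 0 := by simpa [hγ.ne'] using h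
    simp [this]

theorem isEllipticElliptic_qPoint {γ t : ℝ} (hγ : 0 < γ) (ht : 0 ≤ t)
    (v : Set.Icc (-√2) √2) (hv : (v : ℝ) ^ 2 < 2)
    (heq : -1 * (1 - 2 * t) * (v : ℝ) * √(ff ((v : ℝ) ^ 2)) + γ * t * ff ((v : ℝ) ^ 2) +
      γ * t * (v : ℝ) ^ 2 * deriv ff ((v : ℝ) ^ 2) = 0) :
    IsEllipticElliptic J (Ht γ t) (qPoint v) := by
  rw [← param_four v hv]
  -- Here |z₁|² = 6 - |z₅|² and |z₃|² = 4 + |z₅|² - |z₆|²; the latter changes the sign of C.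
  refine isEllipticElliptic_edge (κ := 3) (j := -1 / 2) (κ₀ := 2 * (1 - 2 * t))
    (κ₁ := (1 - 2 * t) / 2) (C := -(1 - 2 * t)) (τ := γ * t) (Ψ := fun a b =>
      sqMod 4 a b 1 * sqMod 4 a b 2 * sqMod 4 a b 3 * sqMod 4 a b 6 * sqMod 4 a b 7)
    (mem_V_four hv) (fun y => ?_) (fun y => ?_) (by norm_num) ?_ (fun b => ?_) hv
    (by positivity) (fun h => ?_) (by linear_combination heq)
  · rw [J_param]
    simp [affineModel, sqAt, sqMod, det2, normal, offset]
    ring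
  · rw [Ht, H_param, X_param_four]
    simp only [edgeModel, sqAt]
    have : sqMod 4 (y.1 0 ^ 2 + y.1 1 ^ 2) (y.1 2 ^ 2 + y.1 3 ^ 2) 2 =
        4 + (y.1 0 ^ 2 + y.1 1 ^ 2) - (y.1 2 ^ 2 + y.1 3 ^ 2) := by
      simp [sqMod, det2, normal, offset]; ring
    simp only [this]
    ring
  · unfold sqMod
    fun_prop
  · simp [sqMod, det2, normal, offset, ff]
    ring
  · have : t = 0 := by simpa [hγ.ne'] using h
    simp [this]

theorem isEllipticElliptic_pPoint_vertex (γ : ℝ) (u : Set.Icc (-√2) √2) (hu : (u : ℝ) = √2) :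
    IsEllipticElliptic J (Ht γ 0) (pPoint u) := by
  rw [← param_seven u hu]
  refine isEllipticElliptic_vertex (κ := 0) (j := 1 / 2) (κ₀ := 2) (κ₁ := -1 / 2)
    (κ₂ := 1 / 2) mem_V_seven (fun y => ?_) (fun y => ?_) (by norm_num) (by norm_num)
  · rw [J_param]
    simp [affineModel, sqAt, sqMod, det2, normal, offset]
    ring
  · rw [Ht, H_param]
    simp [affineModel, sqAt, sqMod, det2, normal, offset]
    ring

theorem isEllipticElliptic_qPoint_vertex (γ : ℝ) (v : Set.Icc (-√2) √2) (hv : (v : ℝ) = -√2) :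
    IsEllipticElliptic J (Ht γ 0) (qPoint v) := by
  rw [← param_three v hv]
  refine isEllipticElliptic_vertex (κ := 3) (j := -1 / 2) (κ₀ := 1) (κ₁ := 1 / 2)
    (κ₂ := -1 / 2) mem_V_three (fun y => ?_) (fun y => ?_) (by norm_num) (by norm_num)
  · rw [J_param]
    simp [affineModel, sqAt, sqMod, det2, normal, offset]
    ring
  · rw [Ht, H_param]
    simp [affineModel, sqAt, sqMod, det2, normal, offset]
    ring

/-- At ζ = 2 the polynomial 𝔣 has a simple zero, so only the nonzero term 2 γ t 𝔣'(2) would survive.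
-/
theorem sq_lt_two_of_equation {γ t s : ℝ} (hγ : 0 < γ) (ht : 0 < t) (u : Set.Icc (-√2) √2)
    (heq : s * (1 - 2 * t) * (u : ℝ) * √(ff ((u : ℝ) ^ 2)) + γ * t * ff ((u : ℝ) ^ 2) +
      γ * t * (u : ℝ) ^ 2 * deriv ff ((u : ℝ) ^ 2) = 0) : (u : ℝ) ^ 2 < 2 := by
  refine lt_of_le_of_ne (sq_le_two u) fun h => ?_
  rw [h, deriv_ff, show ff 2 = 0 by norm_num [ff]] at heq
  norm_num [hγ.ne', ht.ne'] at heq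

theorem IsBranch.isEllipticElliptic_pPoint {γ u₀ : ℝ} {u : ℝ → Set.Icc (-√2) √2} (hγ : 0 < γ)
    (h : IsBranch γ 1 u₀ u) (h0 : u₀ = 0 ∨ u₀ = √2) {t : ℝ} (ht : t ∈ Set.Icc (0 : ℝ) 1) :
    IsEllipticElliptic J (Ht γ t) (pPoint (u t)) := by
  rcases ht.1.eq_or_lt with rfl | hpos
  -- At t = 0 the equation also allows u² = 2, so the initial value decides between the edge chart
  -- and the vertex chart.
  · rcases h0 with rfl | rfl
    · exact Octagon.isEllipticElliptic_pPoint hγ le_rfl _ (by rw [h.initial]; norm_num)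
        (h.equation 0 ht)
    · exact isEllipticElliptic_pPoint_vertex γ _ h.initial
  · exact Octagon.isEllipticElliptic_pPoint hγ ht.1 _
      (sq_lt_two_of_equation hγ hpos _ (h.equation t ht)) (h.equation t ht)

theorem IsBranch.isEllipticElliptic_qPoint {γ u₀ : ℝ} {u : ℝ → Set.Icc (-√2) √2} (hγ : 0 < γ)
    (h : IsBranch γ (-1) u₀ u) (h0 : u₀ = 0 ∨ u₀ = -√2) {t : ℝ} (ht : t ∈ Set.Icc (0 : ℝ) 1) :
    IsEllipticElliptic J (Ht γ t) (qPoint (u t)) := by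
  rcases ht.1.eq_or_lt with rfl | hpos
  · rcases h0 with rfl | rfl
    · exact Octagon.isEllipticElliptic_qPoint hγ le_rfl _ (by rw [h.initial]; norm_num)
        (h.equation 0 ht)
    · exact isEllipticElliptic_qPoint_vertex γ _ h.initial
  · exact Octagon.isEllipticElliptic_qPoint hγ ht.1 _
      (sq_lt_two_of_equation hγ hpos _ (h.equation t ht)) (h.equation t ht)

theorem IsEllipticElliptic.isNondegenerate {f g : M → ℝ} {p : M}
    (h : IsEllipticElliptic f g p) : IsNondegenerateFixedPoint f g p :=
  let ⟨ν, x, hp, hfix, hspan, _⟩ := h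
  ⟨ν, x, hp, hfix, hspan⟩

end Octagon

end

theorem mainTheorem6 (γ : ℝ) (hγ : 0 < γ) :
    (∃ uMin uMax vMin vMax : ℝ → Set.Icc (-√2) √2,
      Octagon.IsBranch γ 1 0 uMin ∧ Octagon.IsBranch γ 1 (√2) uMax ∧
      Octagon.IsBranch γ (-1) (-√2) vMin ∧ Octagon.IsBranch γ (-1) 0 vMax) ∧
    ∀ uMin uMax vMin vMax : ℝ → Set.Icc (-√2) √2,
      Octagon.IsBranch γ 1 0 uMin → Octagon.IsBranch γ 1 (√2) uMax →
      Octagon.IsBranch γ (-1) (-√2) vMin → Octagon.IsBranch γ (-1) 0 vMax →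
      ∀ t ∈ Set.Icc (0 : ℝ) 1,
        ∀ p ∈ ({Octagon.pPoint (uMin t), Octagon.pPoint (uMax t),
            Octagon.qPoint (vMin t), Octagon.qPoint (vMax t)} : Set Octagon.M),
          Octagon.IsNondegenerateFixedPoint Octagon.J (Octagon.Ht γ t) p ∧
          Octagon.IsEllipticElliptic Octagon.J (Octagon.Ht γ t) p := by
  refine ⟨?_, fun uMin uMax vMin vMax h1 h2 h3 h4 t ht p hp => ?_⟩
  · obtain ⟨uMin, uMax, h1, h2⟩ := Octagon.exists_branches hγ
    -- Reflection reverses the order: v₋ = -u₊ and v₊ = -u₋.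
    exact ⟨uMin, uMax, _, _, h1, h2, h2.neg, by simpa using h1.neg⟩
  · have h : Octagon.IsEllipticElliptic Octagon.J (Octagon.Ht γ t) p := by
      rcases hp with rfl | rfl | rfl | rfl
      · exact h1.isEllipticElliptic_pPoint hγ (Or.inl rfl) ht
      · exact h2.isEllipticElliptic_pPoint hγ (Or.inr rfl) ht
      · exact h3.isEllipticElliptic_qPoint hγ (Or.inr rfl) ht
      · exact h4.isEllipticElliptic_qPoint hγ (Or.inl rfl) ht
    exact ⟨h.isNondegenerate, h⟩
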